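/- Let $d\ge 1$, $s,k\ge 0$ be integers, $\Omega\subset\mathbb R^d$, and let $\Pi^d_s$ be the space of $d$-variate real polynomials of total degree at most $s-1$ ($\Pi^d_0=\{0\}$), with basis $p_1,\dots,p_M$. Let $K:\Omega\times\Omega\to\mathbb R$ be a symmetric conditionally positive definite kernel of order $s$: $\sum_{i,j}c_ic_jK(y_i,y_j)>0$ for all finite sets of distinct points $y_1,\dots,y_n\in\Omega$ and all $c\ne 0$ with $\sum_i c_ip(y_i)=0$ for all $p\in\Pi^d_s$. Let $\mathcal F_K$ with seminorm $\|\cdot\|_K$ be the native space of $K$, that is, the completion, as a space of functions on $\Omega$, of the functions $\sum_i c_iK(\cdot,y_i)+p$ with such $y_i$, with $p\in\Pi^d_s$ and with $c$ satisfying $\sum_i c_ip'(y_i)=0$ for all $p'\in\Pi^d_s$ ($c=0$ is allowed), with respect to the seminorm $(\sum_{i,j}c_ic_jK(y_i,y_j))^{1/2}$. Let $Df=\sum_{|\alpha|\le k}a_\alpha\partial^\alpha f$ be a linear differential operator with variable coefficients, let $z\in\Omega$, let $X=\{x_1,\dots,x_N\}$ consist of $N\ge1$ distinct points, and let $S=\bigcup_{j}[z,x_j]\subset\Omega$.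 Assume that the linear system $$\sum_{j=1}^N w_jp_i(x_j)=Dp_i(z),\qquad 1\le i\le M,\tag{1}$$ has a solution $w\in\mathbb R^N$, and that for some integer $r\ge k$ the kernel $K$ possesses continuous partial derivatives $\partial^{\alpha,\beta}K(x,y)$ ($\partial^\alpha$ in $x$, $\partial^\beta$ in $y$) for all $|\alpha|,|\beta|\le r$ and all $x,y$ in an open set $U$ with $S\subset U\subset\Omega$. Then there is exactly one $w^*\in\mathbb R^N$ that satisfies (1) and, with some $v\in\mathbb R^M$, $$\sum_{j=1}^N w^*_jK(x_i,x_j)+\sum_{l=1}^M v_lp_l(x_i)=D K(\cdot,x_i)(z),\qquad 1\le i\le N.$$ Moreover, for every integer $q$ with $\max\{s,k+1\}\le q\le r$ and every $f\in\mathcal F_K$, the partial derivatives of $f$ up to order $k$ exist at $z$ and in a neighbourhood of it, and $$\Big|Df(z)-\sum_{j=1}^N w^*_jf(x_j)\Big|\le\rho_{q,D}(z,X,q)\,|K|_{z,X,q}^{1/2}\,\|f\|_K .$$ Here $$\rho_{q,D}(z,X,q)=\sup\{Dp(z):p\in\Pi^d_q,\ |p(x_j)|\le\|x_j-z\|_2^{q},\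 j=1,\dots,N\}$$ (if this is $+\infty$, the estimate is understood as void) and $$|K|_{z,X,q}=\frac{1}{(q!)^2}\Big(\sum_{|\alpha|=|\beta|=q-1}\tfrac{(q-1)!}{\alpha!}\tfrac{(q-1)!}{\beta!}\,\big|\partial^{\alpha,\beta}K\big|_{z,X,1}^2\Big)^{1/2}<\infty,$$ $$|V|_{z,X,1}=\sup_{x,y\in S\setminus\{z\}}\frac{|V(x,y)-V(x,z)-V(z,y)+V(z,z)|}{\|x-z\|_2\,\|y-z\|_2}.$$ The set $X$ need not be a determining set for $\Pi^d_s$. -/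

import Mathlib

open Set Filter Topology
open scoped ENNReal

noncomputable section

namespace KernelDiff

/-- `ℝᵈ` with the Euclidean norm. -/
abbrev Pt (d : ℕ) : Type := EuclideanSpace ℝ (Fin d)

/-- The `i`-th coordinate direction of `ℝᵈ`. -/
def coordDir {d : ℕ} (i : Fin d) : Pt d := EuclideanSpace.single i 1

/-- Iterated directional derivative of `F` along a list of vectors;
the last vector of the list is differentiated first. -/
def iterLineDeriv {V : Type*} [AddCommGroup V] [Module ℝ V] (F : V → ℝ) : List V → V → ℝ
  | [] => F
  | v :: l => fun p => lineDeriv ℝ (iterLineDeriv F l) p v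

/-- The list of coordinate indices in which `i` occurs `α i` times, in increasing order. -/
def indexList {d : ℕ} (α : Fin d → ℕ) : List (Fin d) :=
  (List.finRange d).flatMap fun i => List.replicate (α i) i

/-- The partial derivative `∂^α f`. -/
def partialDeriv {d : ℕ} (α : Fin d → ℕ) (f : Pt d → ℝ) : Pt d → ℝ :=
  iterLineDeriv f ((indexList α).map coordDir)

/-- All partial derivatives of `f` of order at most `k` exist in a neighbourhood of `z`. -/
def HasPartialsNear {d : ℕ} (f : Pt d → ℝ) (k : ℕ) (z : Pt d) : Prop :=
  ∀ l : List (Fin d), l.length < k → ∀ i : Fin d,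
    ∀ᶠ y in 𝓝 z, LineDifferentiableAt ℝ (iterLineDeriv f (l.map coordDir)) y (coordDir i)

/-- The value at `z` of `D f = ∑_{|α| ≤ k} a_α ∂^α f`, with variable coefficients `a_α`. -/
def diffOp {d : ℕ} (k : ℕ) (a : (Fin d → ℕ) → Pt d → ℝ) (f : Pt d → ℝ) (z : Pt d) : ℝ :=
  ∑ n ∈ Finset.range (k + 1), ∑ α ∈ Finset.piAntidiag (Finset.univ : Finset (Fin d)) n,
    a α z * partialDeriv α f z

/-- A coordinate direction in the first (`Sum.inl i`) or second (`Sum.inr i`) argument of a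
function of two points. -/
def pairDir {d : ℕ} : Fin d ⊕ Fin d → Pt d × Pt d
  | Sum.inl i => (coordDir i, 0)
  | Sum.inr i => (0, coordDir i)

/-- Iterated partial derivative of `K (x, y)` along a list of coordinates of `x` and of `y`. -/
def mixedPartial {d : ℕ} (K : Pt d → Pt d → ℝ) (l : List (Fin d ⊕ Fin d)) : Pt d × Pt d → ℝ :=
  iterLineDeriv (fun p : Pt d × Pt d => K p.1 p.2) (l.map pairDir)

/-- The partial derivative `∂^{α,β} K`: `∂^α` in the first and `∂^β` in the second argument. -/
def kernelPartial {d : ℕ} (α β : Fin d → ℕ) (K : Pt d → Pt d → ℝ) : Pt d → Pt d → ℝ :=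
  fun x y => mixedPartial K ((indexList α).map Sum.inl ++ (indexList β).map Sum.inr) (x, y)

/-- On `U × U` (with `U` open), `K` has continuous partial derivatives of order at most `r` in the
first and at most `r` in the second argument, taken in any order. -/
def HasContinuousPartials {d : ℕ} (K : Pt d → Pt d → ℝ) (r : ℕ) (U : Set (Pt d)) : Prop :=
  ∀ l : List (Fin d ⊕ Fin d), l.countP (fun c => c.isLeft) ≤ r →
    l.countP (fun c => c.isRight) ≤ r →
    ContinuousOn (mixedPartial K l) (U ×ˢ U) ∧
    ∀ c l', l = c :: l' → ∀ p ∈ U ×ˢ U, LineDifferentiableAt ℝ (mixedPartial K l') p (pairDir c)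

/-- The space of polynomials in `d` variables of total degree less than `s`
(the zero space for `s = 0`). -/
def polySpace (d s : ℕ) : Submodule ℝ (MvPolynomial (Fin d) ℝ) :=
  MvPolynomial.restrictSupport ℝ {m : Fin d →₀ ℕ | m.degree < s}

/-- A polynomial as a function on `ℝᵈ`. -/
def polyFun {d : ℕ} (p : MvPolynomial (Fin d) ℝ) (x : Pt d) : ℝ :=
  MvPolynomial.eval (fun i => x i) p

/-- The coefficients `c` (of the functional `f ↦ ∑ c_x f(x)`, or of the function `∑ c_x K(·, x)`)
are supported in `Ω` and annihilate the polynomials of degree less than `s`. -/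
def Annihilates {d : ℕ} (Ω : Set (Pt d)) (s : ℕ) (c : Pt d →₀ ℝ) : Prop :=
  (∀ x ∈ c.support, x ∈ Ω) ∧ ∀ p ∈ polySpace d s, (c.sum fun x cx => cx * polyFun p x) = 0

/-- The quadratic form `∑_{x,y} c_x c_y K(x,y)`. -/
def quadForm {d : ℕ} (K : Pt d → Pt d → ℝ) (c : Pt d →₀ ℝ) : ℝ :=
  c.sum fun x cx => c.sum fun y cy => cx * cy * K x y

/-- `K` is a symmetric conditionally positive definite kernel of order `s` on `Ω`
(strictly positive definite for `s = 0`). -/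
def IsCPD {d : ℕ} (K : Pt d → Pt d → ℝ) (Ω : Set (Pt d)) (s : ℕ) : Prop :=
  (∀ x ∈ Ω, ∀ y ∈ Ω, K x y = K y x) ∧
  ∀ c : Pt d →₀ ℝ, Annihilates Ω s c → c ≠ 0 → 0 < quadForm K c

/-- The function `f : Ω → ℝ` is the pointwise limit on `Ω` of functions
`∑_x (c n)_x K(·, x) + p n`, with `c n` annihilating the polynomials `p n` of degree less than `s`,
which form a Cauchy sequence for the seminorm `(∑_{x,y} c_x c_y K(x,y))^{1/2}`. -/
def IsNativeApprox {d : ℕ} (K : Pt d → Pt d → ℝ) (Ω : Set (Pt d)) (s : ℕ) (f : Pt d → ℝ)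
    (c : ℕ → Pt d →₀ ℝ) (p : ℕ → MvPolynomial (Fin d) ℝ) : Prop :=
  (∀ n, Annihilates Ω s (c n)) ∧ (∀ n, p n ∈ polySpace d s) ∧
  (∀ ε > 0, ∃ n₀, ∀ m ≥ n₀, ∀ n ≥ n₀, quadForm K (c m - c n) < ε) ∧
  ∀ x ∈ Ω, Tendsto (fun n => ((c n).sum fun y cy => cy * K x y) + polyFun (p n) x) atTop (𝓝 (f x))

/-- The native space of `K` on `Ω`: the completion, realized as functions on `Ω`, of the space of
functions `∑_x c_x K(·, x) + p` as above. Only the values of `f` on `Ω` matter. -/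
def nativeSpace {d : ℕ} (K : Pt d → Pt d → ℝ) (Ω : Set (Pt d)) (s : ℕ) : Set (Pt d → ℝ) :=
  {f | ∃ c p, IsNativeApprox K Ω s f c p}

/-- The native seminorm `‖f‖_K = lim (∑_{x,y} (c n)_x (c n)_y K(x,y))^{1/2}`. The limit is the same
for all approximating sequences, so that the set below has one element for `f` in the native
space. -/
def nativeNorm {d : ℕ} (K : Pt d → Pt d → ℝ) (Ω : Set (Pt d)) (s : ℕ) (f : Pt d → ℝ) : ℝ :=
  sInf {C : ℝ | ∃ c p, IsNativeApprox K Ω s f c p ∧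
    Tendsto (fun n => Real.sqrt (quadForm K (c n))) atTop (𝓝 C)}

/-- The union of the segments from `z` to the points `x j`. -/
def starSet {d N : ℕ} (z : Pt d) (x : Fin N → Pt d) : Set (Pt d) :=
  ⋃ j, segment ℝ z (x j)

/-- The Hölder-type seminorm `|U|_{z,X,γ}`, `0 < γ ≤ 1`, possibly infinite. -/
def holderSeminorm {d N : ℕ} (U : Pt d → Pt d → ℝ) (z : Pt d) (x : Fin N → Pt d) (γ : ℝ) : ℝ≥0∞ :=
  ⨆ u ∈ starSet z x \ {z}, ⨆ v ∈ starSet z x \ {z},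
    ENNReal.ofReal (|U u v - U u z - U z v + U z z| / (‖u - z‖ ^ γ * ‖v - z‖ ^ γ))

/-- The seminorm `|K|_{z,X,m+γ}` for `m : ℕ` and `0 < γ ≤ 1`, possibly infinite. -/
def kernelSeminorm {d N : ℕ} (K : Pt d → Pt d → ℝ) (z : Pt d) (x : Fin N → Pt d)
    (m : ℕ) (γ : ℝ) : ℝ≥0∞ :=
  ENNReal.ofReal (1 / ∏ i ∈ Finset.Icc 1 m, (γ + (i : ℝ)) ^ 2) *
    (∑ α ∈ Finset.piAntidiag (Finset.univ : Finset (Fin d)) m,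
      ∑ β ∈ Finset.piAntidiag (Finset.univ : Finset (Fin d)) m,
        (Nat.multinomial Finset.univ α : ℝ≥0∞) * (Nat.multinomial Finset.univ β : ℝ≥0∞) *
          holderSeminorm (kernelPartial α β K) z x γ ^ 2) ^ (1 / 2 : ℝ)

/-- The growth function
`ρ_{q,D}(z,X,μ) = sup {D p(z) : p of degree < q, |p(x_j)| ≤ ‖x_j - z‖^μ for all j}`,
possibly infinite (the supremum is at least `0`, as `p = 0` is admitted). -/
def growthFunction {d N : ℕ} (k : ℕ) (a : (Fin d → ℕ) → Pt d → ℝ) (q : ℕ) (z : Pt d)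
    (x : Fin N → Pt d) (μ : ℝ) : ℝ≥0∞ :=
  ⨆ p ∈ {p ∈ polySpace d q | ∀ j, |polyFun p (x j)| ≤ ‖x j - z‖ ^ μ},
    ENNReal.ofReal (diffOp k a (polyFun p) z)

/-- `w` satisfies the polynomial exactness conditions `∑_j w_j p_i(x_j) = D p_i(z)` for the
basis polynomials `p_i`. -/
def IsExactOn {d N M : ℕ} (k : ℕ) (a : (Fin d → ℕ) → Pt d → ℝ) (z : Pt d) (x : Fin N → Pt d)
    (p : Fin M → MvPolynomial (Fin d) ℝ) (w : Fin N → ℝ) : Prop :=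
  ∀ i, ∑ j, w j * polyFun (p i) (x j) = diffOp k a (polyFun (p i)) z

/-- `w` is a weight vector of the kernel-based numerical differentiation formula: together with
some `v` it solves the linear system defining the formula. -/
def IsKernelWeight {d N M : ℕ} (K : Pt d → Pt d → ℝ) (k : ℕ) (a : (Fin d → ℕ) → Pt d → ℝ)
    (z : Pt d) (x : Fin N → Pt d) (p : Fin M → MvPolynomial (Fin d) ℝ) (w : Fin N → ℝ) : Prop :=
  (∃ v : Fin M → ℝ, ∀ i, ∑ j, w j * K (x i) (x j) + ∑ l, v l * polyFun (p l) (x i) =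
    diffOp k a (fun y => K y (x i)) z) ∧
  IsExactOn k a z x p w

end KernelDiff

end

/-! Let `H` be the completion of the finitely supported functionals on `Ω` that annihilate `Π_s`,
with the inner product given by `K`. Since `δ_y` itself need not annihilate `Π_s`, it is replaced by
`δ_y - ∑ ℓ_ξ(y) δ_ξ`, where the finitely many nodes `ξ` are chosen in `U` so that interpolation with
the polynomials `ℓ_ξ` reproduces `Π_s` on `U`. These nodes are unrelated to `X`, which therefore
need not be determining. The Gram kernel of this feature map is `K` plus polynomial corrections, and
its smoothness passes to the map itself (`exists_isPartialFamily_of_gram`). On `U` a native function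
is an inner product with the feature map plus a polynomial in `Π_s`. So it is differentiable, and
the error of any weights exact on `Π_s` is an inner product with an error vector (`error_eq_inner`).

By the kernel equations the error vector of `w*` is orthogonal to all combinations of evaluations at
`X` that annihilate `Π_s`. By Pythagoras its norm is minimal among weights exact on `Π_s`, so it is
enough to estimate one competitor that is exact on `Π_q`. Hahn–Banach supplies one with `∑ |w_j|
‖x_j - z‖^q` bounded by the growth function (`exists_weights`).

Let `e` be the error vector of the competitor. Then `‖e‖²` is the error of the formula on the
function `y ↦ ⟨Ψ 0 y, e⟩`. Subtracting its Taylor polynomial at `z` of degree less than `q` changes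
nothing by exactness, and removes the derivatives at `z`, because `k < q`. Only the remainders at
the `x_j` survive, each at most `‖x_j - z‖^q |K|^{1/2} ‖e‖` (`exists_taylor_error_le`), and one
factor `‖e‖` cancels.

The remainder bound uses differences of the derivatives of order `q - 1` of the feature map. Their
inner products are exactly the second differences of `∂^{α,β}K`: for `q ≥ s` the polynomial
corrections have constant derivatives of that order. Cauchy–Schwarz over the multi-indices and
repeated integration then give the stated constant. -/

namespace KernelDiff

noncomputable section

/-! ### Line derivatives: additivity in the direction and symmetry -/

section LineDerivatives

variable {E F : Type*} [NormedAddCommGroup E] [NormedSpace ℝ E]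
  [NormedAddCommGroup F] [NormedSpace ℝ F]

theorem hasDerivAt_comp_line {f : E → F} {f' : F} {y v : E} {s : ℝ}
    (h : HasLineDerivAt ℝ f f' (y + s • v) v) :
    HasDerivAt (fun t : ℝ => f (y + t • v)) f' s := by
  have h1 : HasDerivAt (fun t : ℝ => f (y + s • v + t • v)) f' (s - s) := by
    simpa [HasLineDerivAt] using h
  have := h1.comp_sub_const s s
  convert this using 3 with t
  rw [sub_smul]; abel

/-- Points `y + s v + t w` with small `s`, `t` lie in a given neighbourhood of `y`. -/
theorem exists_delta_mem {U : Set E} {y : E} (hU : U ∈ 𝓝 y) (v w : E) :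
    ∃ δ > 0, ∀ s t : ℝ, |s| < δ → |t| < δ → y + s • v + t • w ∈ U := by
  have hc : ContinuousAt (fun p : ℝ × ℝ => y + p.1 • v + p.2 • w) (0, 0) := by fun_prop
  have h1 : (fun p : ℝ × ℝ => y + p.1 • v + p.2 • w) ⁻¹' U ∈ 𝓝 ((0 : ℝ), (0 : ℝ)) :=
    hc.preimage_mem_nhds (by simpa using hU)
  obtain ⟨δ, hδ, h⟩ := Metric.mem_nhds_iff.1 h1
  refine ⟨δ, hδ, fun s t hs ht => ?_⟩
  apply h (show (s, t) ∈ Metric.ball ((0 : ℝ), (0 : ℝ)) δ from ?_)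
  simp [Prod.dist_eq, hs, ht]

/-- A line derivative is additive in the direction, if the derivative in the second direction
exists in a neighbourhood and is continuous. -/
theorem hasLineDerivAt_add_of_continuousAt {f g : E → F} {y v w : E} {f' : F}
    (hv : HasLineDerivAt ℝ f f' y v) (hw : ∀ᶠ x in 𝓝 y, HasLineDerivAt ℝ f (g x) x w)
    (hg : ContinuousAt g y) : HasLineDerivAt ℝ f (f' + g y) y (v + w) := by
  -- The base point `y + t v` of the second increment moves with `t`. The mean value inequality for
  -- `s ↦ f (y + t v + s w) - s g(y)`, whose derivative is small by continuity of `g`, gives this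
  -- increment up to `o(t)`.
  have key : (fun t : ℝ => f (y + t • v + t • w) - f (y + t • v) - t • g y)
      =o[𝓝 0] (fun t : ℝ => t) := by
    rw [Asymptotics.isLittleO_iff]
    intro ε hε
    have h1 : ∀ᶠ x in 𝓝 y, HasLineDerivAt ℝ f (g x) x w ∧ ‖g x - g y‖ ≤ ε := by
      refine hw.and ?_
      filter_upwards [hg (Metric.ball_mem_nhds _ hε)] with x hx
      have : dist (g x) (g y) < ε := hx
      rw [dist_eq_norm] at this
      exact this.le
    obtain ⟨δ, hδ, h⟩ := exists_delta_mem h1 v w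
    filter_upwards [Metric.ball_mem_nhds (0 : ℝ) hδ] with t ht
    have ht : |t| < δ := by simpa using ht
    have hseg : ∀ s ∈ uIcc 0 t, |s| < δ := fun s hs => by
      have := abs_sub_left_of_mem_uIcc hs
      simp at this
      exact this.trans_lt ht
    have hd : ∀ s ∈ uIcc 0 t, HasDerivWithinAt (fun s : ℝ => f (y + t • v + s • w) - s • g y)
        (g (y + t • v + s • w) - (1 : ℝ) • g y) (uIcc 0 t) s := fun s hs =>
      ((hasDerivAt_comp_line (h t s ht (hseg s hs)).1).sub
        ((hasDerivAt_id s).smul_const (g y))).hasDerivWithinAt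
    have := (convex_uIcc (0 : ℝ) t).norm_image_sub_le_of_norm_hasDerivWithin_le hd (C := ε)
      (fun s hs => by simpa using (h t s ht (hseg s hs)).2) left_mem_uIcc right_mem_uIcc
    simpa [sub_right_comm] using this
  have h2 := (hasDerivAt_iff_isLittleO.1 hv)
  rw [HasLineDerivAt, hasDerivAt_iff_isLittleO]
  have h3 := (key.add (by simpa using h2))
  simp only [sub_zero, zero_smul, add_zero]
  refine h3.congr_left fun t => ?_
  simp only [smul_add, add_assoc]; abel

/-- The mean value theorem in the parameter `θ ∈ [0, 1]` of `s = θ t`, which treats both signs of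
`t` and `t = 0` at once. -/
theorem exists_mean_value {g g' : ℝ → ℝ} {t : ℝ}
    (h : ∀ s, |s| ≤ |t| → HasDerivAt g (g' s) s) :
    ∃ s, |s| ≤ |t| ∧ g t - g 0 = t * g' s := by
  have h1 : ∀ θ ∈ Icc (0 : ℝ) 1, HasDerivAt (fun θ => g (θ * t)) (g' (θ * t) * t) θ := by
    intro θ hθ
    have hb : |θ * t| ≤ |t| := by
      rw [abs_mul, abs_of_nonneg hθ.1]
      exact mul_le_of_le_one_left (abs_nonneg _) hθ.2
    have := (h (θ * t) hb).comp θ ((hasDerivAt_id θ).mul_const t)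
    simpa [Function.comp_def] using this
  obtain ⟨θ, hθ, h2⟩ := exists_hasDerivAt_eq_slope (fun θ => g (θ * t))
    (fun θ => g' (θ * t) * t) (zero_lt_one' ℝ)
    (fun θ hθ => (h1 θ hθ).continuousAt.continuousWithinAt)
    (fun θ hθ => h1 θ (Ioo_subset_Icc_self hθ))
  refine ⟨θ * t, ?_, ?_⟩
  · rw [abs_mul, abs_of_nonneg hθ.1.le]
    exact mul_le_of_le_one_left (abs_nonneg _) hθ.2.le
  · simp at h2
    linarith

/-- Two mean value theorems in succession, for `a ↦ G a u - G a 0` and then for `b ↦ G₁ a b`. Both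
the symmetry of second derivatives and the Gram criterion rest on this. -/
theorem exists_second_difference {G G₁ G₁₂ : ℝ → ℝ → ℝ} {t u : ℝ}
    (h₁ : ∀ a b, |a| ≤ |t| → |b| ≤ |u| → HasDerivAt (fun a => G a b) (G₁ a b) a)
    (h₂ : ∀ a b, |a| ≤ |t| → |b| ≤ |u| → HasDerivAt (fun b => G₁ a b) (G₁₂ a b) b) :
    ∃ a b, |a| ≤ |t| ∧ |b| ≤ |u| ∧ G t u - G t 0 - G 0 u + G 0 0 = t * u * G₁₂ a b := by
  obtain ⟨a, ha, h⟩ := exists_mean_value (g := fun a => G a u - G a 0)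
    (g' := fun a => G₁ a u - G₁ a 0) (t := t)
    (fun a ha => (h₁ a u ha le_rfl).sub (h₁ a 0 ha (by simp)))
  obtain ⟨b, hb, h'⟩ := exists_mean_value (g := fun b => G₁ a b) (g' := fun b => G₁₂ a b)
    (t := u) (fun b hb => h₂ a b ha hb)
  refine ⟨a, b, ha, hb, ?_⟩
  rw [mul_assoc, ← h', ← h]; ring

/-- Symmetry of continuous second line derivatives. -/
theorem lineDeriv_comm {W : Set E} (hW : IsOpen W) {f f₁ f₂ f₁₂ f₂₁ : E → ℝ} {v w : E}
    (h₁ : ∀ p ∈ W, HasLineDerivAt ℝ f (f₁ p) p v) (h₂ : ∀ p ∈ W, HasLineDerivAt ℝ f (f₂ p) p w)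
    (h₁₂ : ∀ p ∈ W, HasLineDerivAt ℝ f₁ (f₁₂ p) p w)
    (h₂₁ : ∀ p ∈ W, HasLineDerivAt ℝ f₂ (f₂₁ p) p v)
    (hc₁₂ : ContinuousOn f₁₂ W) (hc₂₁ : ContinuousOn f₂₁ W) {p : E} (hp : p ∈ W) :
    f₁₂ p = f₂₁ p := by
  by_contra hne
  have hε : 0 < |f₁₂ p - f₂₁ p| / 2 := by
    have := abs_pos.2 (sub_ne_zero.2 hne); positivity
  set ε := |f₁₂ p - f₂₁ p| / 2 with hεd
  have hW' := hW.mem_nhds hp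
  have hn : ∀ᶠ x in 𝓝 p, x ∈ W ∧ |f₁₂ x - f₁₂ p| < ε ∧ |f₂₁ x - f₂₁ p| < ε := by
    filter_upwards [hW', (hc₁₂.continuousAt hW') (Metric.ball_mem_nhds _ hε),
      (hc₂₁.continuousAt hW') (Metric.ball_mem_nhds _ hε)] with x hx h1 h2
    exact ⟨hx, by simpa [Real.dist_eq] using h1, by simpa [Real.dist_eq] using h2⟩
  obtain ⟨δ, hδ, h⟩ := exists_delta_mem hn v w
  have hδ2 : |δ / 2| < δ := by rw [abs_of_pos (by positivity)]; linarith
  have hδ0 : (δ / 2) * (δ / 2) ≠ 0 := by positivity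
  have hlt : ∀ a : ℝ, |a| ≤ |δ / 2| → |a| < δ := fun a ha => ha.trans_lt hδ2
  have hswap : ∀ a b : ℝ, p + a • v + b • w = p + b • w + a • v := fun a b => by abel
  obtain ⟨a, b, ha, hb, e1⟩ := exists_second_difference (t := δ / 2) (u := δ / 2)
    (G := fun a b => f (p + a • v + b • w)) (G₁ := fun a b => f₁ (p + a • v + b • w))
    (G₁₂ := fun a b => f₁₂ (p + a • v + b • w))
    (fun a b ha hb => by
      have := (h a b (hlt a ha) (hlt b hb)).1
      simp only [hswap] at this ⊢
      exact hasDerivAt_comp_line (h₁ _ this))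
    (fun a b ha hb => hasDerivAt_comp_line (h₁₂ _ (h a b (hlt a ha) (hlt b hb)).1))
  obtain ⟨b', a', hb', ha', e2⟩ := exists_second_difference (t := δ / 2) (u := δ / 2)
    (G := fun b a => f (p + a • v + b • w)) (G₁ := fun b a => f₂ (p + a • v + b • w))
    (G₁₂ := fun b a => f₂₁ (p + a • v + b • w))
    (fun b a hb ha => hasDerivAt_comp_line (h₂ _ (h a b (hlt a ha) (hlt b hb)).1))
    (fun b a hb ha => by
      have := (h a b (hlt a ha) (hlt b hb)).1
      simp only [hswap] at this ⊢
      exact hasDerivAt_comp_line (h₂₁ _ this))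
  -- Both orders of differentiation evaluate the same second difference of `f` over the
  -- parallelogram with sides `(δ/2) v` and `(δ/2) w`.
  have h3 : f₁₂ (p + a • v + b • w) = f₂₁ (p + a' • v + b' • w) := by
    apply mul_left_cancel₀ hδ0
    rw [← e1, ← e2]; ring
  have h4 := (h a b (hlt a ha) (hlt b hb)).2.1
  have h5 := (h a' b' (hlt a' ha') (hlt b' hb')).2.2
  rw [abs_lt] at h4 h5
  have h6 : |f₁₂ p - f₂₁ p| < ε + ε := by
    rw [abs_lt]; constructor <;> linarith
  linarith

end LineDerivatives

/-! ### Differentiability of a Hilbert space valued map from its Gram kernel -/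

section GramDifferentiability

variable {E H : Type*} [NormedAddCommGroup E] [NormedSpace ℝ E]
  [NormedAddCommGroup H] [InnerProductSpace ℝ H]

/-- A map into a Hilbert space is line differentiable if its Gram kernel has a continuous mixed
second derivative. -/
theorem exists_hasLineDerivAt_of_gram [CompleteSpace H] {U : Set E} (hU : IsOpen U) {Ψ : E → H}
    {v : E} {Q₁ Q₁₁ : E → E → ℝ}
    (h₁ : ∀ x ∈ U, ∀ y ∈ U, HasLineDerivAt ℝ (fun x => inner ℝ (Ψ x) (Ψ y)) (Q₁ x y) x v)
    (h₂ : ∀ x ∈ U, ∀ y ∈ U, HasLineDerivAt ℝ (fun y => Q₁ x y) (Q₁₁ x y) y v)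
    (hc : ContinuousOn (fun p : E × E => Q₁₁ p.1 p.2) (U ×ˢ U)) {x : E} (hx : x ∈ U) :
    ∃ ψ : H, HasLineDerivAt ℝ Ψ ψ x v := by
  set S : ℝ → H := fun t => t⁻¹ • (Ψ (x + t • v) - Ψ x) with hS
  -- The inner product of two difference quotients is a second difference of the Gram kernel divided
  -- by `t u`, hence a nearby value of `Q₁₁`.
  have key : ∀ ε > 0, ∃ δ > 0, ∀ t u : ℝ, t ≠ 0 → u ≠ 0 → |t| < δ → |u| < δ →
      |inner ℝ (S t) (S u) - Q₁₁ x x| < ε := by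
    intro ε hε
    have hUx : U ×ˢ U ∈ 𝓝 (x, x) := (hU.prod hU).mem_nhds ⟨hx, hx⟩
    have hn : ∀ᶠ p : E × E in 𝓝 (x, x), p ∈ U ×ˢ U ∧ |Q₁₁ p.1 p.2 - Q₁₁ x x| < ε := by
      filter_upwards [hUx, (hc.continuousAt hUx) (Metric.ball_mem_nhds _ hε)] with p hp h1
      exact ⟨hp, by simpa [Real.dist_eq] using h1⟩
    obtain ⟨δ, hδ, h⟩ := exists_delta_mem hn ((v, 0) : E × E) ((0, v) : E × E)
    refine ⟨δ, hδ, fun t u ht0 hu0 ht hu => ?_⟩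
    have h' : ∀ a b : ℝ, |a| < δ → |b| < δ → (x + a • v ∈ U ∧ x + b • v ∈ U) ∧
        |Q₁₁ (x + a • v) (x + b • v) - Q₁₁ x x| < ε := fun a b ha hb => by
      simpa using h a b ha hb
    obtain ⟨a, b, ha, hb, e⟩ := exists_second_difference (t := t) (u := u)
      (G := fun a b => inner ℝ (Ψ (x + a • v)) (Ψ (x + b • v)))
      (G₁ := fun a b => Q₁ (x + a • v) (x + b • v))
      (G₁₂ := fun a b => Q₁₁ (x + a • v) (x + b • v))
      (fun a b ha hb => by
        have := (h' a b (ha.trans_lt ht) (hb.trans_lt hu)).1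
        exact hasDerivAt_comp_line (f := fun x => inner ℝ (Ψ x) (Ψ _)) (h₁ _ this.1 _ this.2))
      (fun a b ha hb => by
        have := (h' a b (ha.trans_lt ht) (hb.trans_lt hu)).1
        exact hasDerivAt_comp_line (h₂ _ this.1 _ this.2))
    have e2 : inner ℝ (S t) (S u) = Q₁₁ (x + a • v) (x + b • v) := by
      simp only [zero_smul, add_zero] at e
      simp only [hS, real_inner_smul_left, real_inner_smul_right, inner_sub_left, inner_sub_right]
      field_simp
      linarith
    rw [e2]
    exact (h' a b (ha.trans_lt ht) (hb.trans_lt hu)).2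
  have hcau : Cauchy (map S (𝓝[≠] 0)) := by
    rw [Metric.cauchy_iff]
    refine ⟨inferInstance, fun ε hε => ?_⟩
    -- `‖S t - S u‖²` combines three inner products with coefficients `1, -2, 1`. Each is within
    -- `ε²/4` of `Q₁₁ x x`, so the limits cancel and less than `ε²` remains.
    obtain ⟨δ, hδ, h⟩ := key (ε ^ 2 / 4) (by positivity)
    refine ⟨S '' {t | t ≠ 0 ∧ |t| < δ}, image_mem_map ?_, ?_⟩
    · rw [mem_nhdsWithin]
      refine ⟨Metric.ball 0 δ, Metric.isOpen_ball, by simpa using hδ, fun t ht => ?_⟩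
      exact ⟨ht.2, by simpa using ht.1⟩
    · rintro _ ⟨t, ht, rfl⟩ _ ⟨u, hu, rfl⟩
      have h1 := h t t ht.1 ht.1 ht.2 ht.2
      have h2 := h t u ht.1 hu.1 ht.2 hu.2
      have h3 := h u u hu.1 hu.1 hu.2 hu.2
      rw [abs_lt] at h1 h2 h3
      rw [dist_eq_norm]
      apply lt_of_pow_lt_pow_left₀ 2 hε.le
      rw [norm_sub_sq_real, ← real_inner_self_eq_norm_sq, ← real_inner_self_eq_norm_sq]
      linarith
  obtain ⟨ψ, hψ⟩ := CompleteSpace.complete hcau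
  exact ⟨ψ, hasLineDerivAt_iff_tendsto_slope_zero.2 hψ⟩

theorem HasLineDerivAt.inner_const {Ψ : E → H} {ψ : H} {x v : E}
    (h : HasLineDerivAt ℝ Ψ ψ x v) (e : H) :
    HasLineDerivAt ℝ (fun x => inner ℝ (Ψ x) e) (inner ℝ ψ e) x v := by
  have h1 : HasDerivAt (fun t : ℝ => Ψ (x + t • v)) ψ 0 := h
  have := h1.inner ℝ (hasDerivAt_const (0 : ℝ) e)
  simpa [HasLineDerivAt] using this

end GramDifferentiability

/-! ### Multi-indices and lists of coordinates -/

section MultiIndices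

variable {d : ℕ}

/-- The multi-index counting the occurrences of the coordinates in a list. -/
def listIndex (l : List (Fin d)) : Fin d → ℕ := fun i => l.count i

@[simp] theorem listIndex_nil : listIndex ([] : List (Fin d)) = 0 := by
  ext i; simp [listIndex]

theorem listIndex_cons (i : Fin d) (l : List (Fin d)) :
    listIndex (i :: l) = listIndex l + Pi.single i 1 := by
  ext j
  by_cases h : j = i
  · subst h; simp [listIndex]
  · simp [listIndex, h, Ne.symm h]

theorem sum_add_single (α : Fin d → ℕ) (i : Fin d) :
    ∑ j, (α + Pi.single i 1 : Fin d → ℕ) j = ∑ j, α j + 1 := by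
  simp [Finset.sum_add_distrib]

theorem sum_listIndex (l : List (Fin d)) : ∑ i, listIndex l i = l.length := by
  induction l with
  | nil => simp
  | cons i l ih => rw [listIndex_cons, sum_add_single, ih, List.length_cons]

theorem listIndex_indexList (α : Fin d → ℕ) : listIndex (indexList α) = α := by
  ext i
  simp only [listIndex, indexList, List.count_flatMap, Function.comp_def, List.count_replicate]
  rw [← List.ofFn_eq_map, List.sum_ofFn]
  simp

@[simp] theorem length_indexList (α : Fin d → ℕ) : (indexList α).length = ∑ i, α i := by
  rw [← sum_listIndex, listIndex_indexList]

@[simp] theorem indexList_zero : indexList (0 : Fin d → ℕ) = [] := by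
  rw [← List.length_eq_zero_iff]; simp

theorem perm_indexList (l : List (Fin d)) : l.Perm (indexList (listIndex l)) := by
  rw [List.perm_iff_count]
  intro i
  exact (congrFun (listIndex_indexList (listIndex l)) i).symm

theorem cons_indexList_perm (α : Fin d → ℕ) (i : Fin d) :
    (i :: indexList α).Perm (indexList (α + Pi.single i 1)) := by
  have := perm_indexList (i :: indexList α)
  rwa [listIndex_cons, listIndex_indexList] at this

end MultiIndices

/-! ### Vector-valued families of continuous partial derivatives -/

section Families

variable {d : ℕ} {E : Type*} [NormedAddCommGroup E] [NormedSpace ℝ E]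

/-- `F α` is the continuous partial derivative `∂^α (F 0)` on `U`, for `|α| ≤ r`. -/
structure IsPartialFamily (r : ℕ) (U : Set (Pt d)) (F : (Fin d → ℕ) → Pt d → E) : Prop where
  hasLineDerivAt : ∀ α, ∑ i, α i < r → ∀ y ∈ U, ∀ i,
    HasLineDerivAt ℝ (F α) (F (α + Pi.single i 1) y) y (coordDir i)
  continuousOn : ∀ α, ∑ i, α i ≤ r → ContinuousOn (F α) U

variable {r : ℕ} {U : Set (Pt d)} {F G : (Fin d → ℕ) → Pt d → E}

theorem IsPartialFamily.mono (hF : IsPartialFamily r U F) {m : ℕ} (h : m ≤ r) :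
    IsPartialFamily m U F :=
  ⟨fun α hα => hF.1 α (hα.trans_le h), fun α hα => hF.2 α (hα.trans h)⟩

theorem IsPartialFamily.add (hF : IsPartialFamily r U F) (hG : IsPartialFamily r U G) :
    IsPartialFamily r U (fun α y => F α y + G α y) :=
  ⟨fun α hα y hy i => HasDerivAt.add (hF.1 α hα y hy i) (hG.1 α hα y hy i),
    fun α hα => (hF.2 α hα).add (hG.2 α hα)⟩

theorem IsPartialFamily.sub (hF : IsPartialFamily r U F) (hG : IsPartialFamily r U G) :
    IsPartialFamily r U (fun α y => F α y - G α y) :=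
  ⟨fun α hα y hy i => HasDerivAt.sub (hF.1 α hα y hy i) (hG.1 α hα y hy i),
    fun α hα => (hF.2 α hα).sub (hG.2 α hα)⟩

theorem IsPartialFamily.const_smul (c : ℝ) (hF : IsPartialFamily r U F) :
    IsPartialFamily r U (fun α y => c • F α y) :=
  ⟨fun α hα y hy i => HasDerivAt.const_smul c (hF.1 α hα y hy i),
    fun α hα => (hF.2 α hα).const_smul c⟩

theorem IsPartialFamily.sum {ι : Type*} (s : Finset ι) {F : ι → (Fin d → ℕ) → Pt d → E}
    (hF : ∀ j ∈ s, IsPartialFamily r U (F j)) :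
    IsPartialFamily r U (fun α y => ∑ j ∈ s, F j α y) :=
  ⟨fun α hα y hy i => HasDerivAt.fun_sum fun j hj => (hF j hj).1 α hα y hy i,
    fun α hα => continuousOn_finsetSum _ fun j hj => (hF j hj).2 α hα⟩

theorem IsPartialFamily.inner_const {H : Type*} [NormedAddCommGroup H] [InnerProductSpace ℝ H]
    {F : (Fin d → ℕ) → Pt d → H} (hF : IsPartialFamily r U F) (e : H) :
    IsPartialFamily r U (fun α y => inner ℝ (F α y) e) :=
  ⟨fun α hα y hy i => HasLineDerivAt.inner_const (hF.1 α hα y hy i) e,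
    fun α hα => (hF.2 α hα).inner continuousOn_const⟩

theorem sum_smul_coordDir (h : Pt d) : ∑ i, h i • (coordDir i : Pt d) = h := by
  ext j
  simp [coordDir, Finset.sum_apply, Pi.single_apply]

/-- The coordinate components of `h` are added one at a time. Only the newly added direction needs a
continuous derivative nearby, so no Fréchet derivative enters. -/
theorem IsPartialFamily.hasLineDerivAt_dir (hU : IsOpen U) (hF : IsPartialFamily r U F)
    {α : Fin d → ℕ} (hα : ∑ i, α i < r) {y : Pt d} (hy : y ∈ U) (h : Pt d) :
    HasLineDerivAt ℝ (F α) (∑ i, h i • F (α + Pi.single i 1) y) y h := by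
  have key : ∀ s : Finset (Fin d), HasLineDerivAt ℝ (F α)
      (∑ i ∈ s, h i • F (α + Pi.single i 1) y) y (∑ i ∈ s, h i • (coordDir i : Pt d)) := by
    intro s
    induction s using Finset.induction_on with
    | empty => simpa using! (hasLineDerivAt_zero (𝕜 := ℝ) (f := F α) (x := y))
    | insert i s hi ih =>
      rw [Finset.sum_insert hi, Finset.sum_insert hi, add_comm, add_comm (h i • coordDir i)]
      refine hasLineDerivAt_add_of_continuousAt (g := fun y => h i • F (α + Pi.single i 1) y)
        ih ?_ ?_
      · filter_upwards [hU.mem_nhds hy] with x hx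
        exact (hF.1 α hα x hx i).smul (h i)
      · exact ((hF.2 _ (by rw [sum_add_single]; omega)).continuousAt
          (hU.mem_nhds hy)).const_smul (h i)
  simpa only [sum_smul_coordDir] using key Finset.univ

theorem hasLineDerivAt_congr_of_eventuallyEq {V : Type*} [NormedAddCommGroup V] [NormedSpace ℝ V]
    {f g : V → E} {f' : E} {y v : V} (hg : HasLineDerivAt ℝ g f' y v) (h : f =ᶠ[𝓝 y] g) :
    HasLineDerivAt ℝ f f' y v :=
  h.hasLineDerivAt_iff.2 hg

end Families

/-! ### Identification with iterated partial derivatives, and the operator `D` -/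

section ScalarFamilies

variable {d r : ℕ} {U : Set (Pt d)} {F : (Fin d → ℕ) → Pt d → ℝ} {f : Pt d → ℝ}

/-- Agreement on a whole open set, not merely at one point, allows the induction to differentiate
once more. -/
theorem IsPartialFamily.iterLineDeriv_eqOn (hU : IsOpen U) (hF : IsPartialFamily r U F)
    (hf : EqOn f (F 0) U) (l : List (Fin d)) (hl : l.length ≤ r) :
    EqOn (iterLineDeriv f (l.map coordDir)) (F (listIndex l)) U := by
  induction l with
  | nil => simpa [iterLineDeriv] using hf
  | cons i l ih =>
    rw [List.length_cons] at hl
    intro y hy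
    have h1 := hF.1 (listIndex l) (by rw [sum_listIndex]; omega) y hy i
    have h2 := hasLineDerivAt_congr_of_eventuallyEq h1
      ((ih (by omega)).eventuallyEq_of_mem (hU.mem_nhds hy))
    rw [listIndex_cons]
    exact h2.lineDeriv

theorem IsPartialFamily.partialDeriv_eq (hU : IsOpen U) (hF : IsPartialFamily r U F)
    (hf : EqOn f (F 0) U) {α : Fin d → ℕ} (hα : ∑ i, α i ≤ r) {y : Pt d} (hy : y ∈ U) :
    partialDeriv α f y = F α y := by
  have := hF.iterLineDeriv_eqOn hU hf (indexList α) (by simpa using hα) hy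
  rwa [listIndex_indexList] at this

theorem IsPartialFamily.hasPartialsNear (hU : IsOpen U) (hF : IsPartialFamily r U F)
    (hf : EqOn f (F 0) U) {k : ℕ} (hk : k ≤ r) {z : Pt d} (hz : z ∈ U) :
    HasPartialsNear f k z := by
  intro l hl i
  filter_upwards [hU.mem_nhds hz] with y hy
  have h1 := hF.1 (listIndex l) (by rw [sum_listIndex]; omega) y hy i
  exact (hasLineDerivAt_congr_of_eventuallyEq h1
    ((hF.iterLineDeriv_eqOn hU hf l (by omega)).eventuallyEq_of_mem
      (hU.mem_nhds hy))).lineDifferentiableAt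

/-- The operator `∑ a_α ∂^α` at `z`, applied to a family of partial derivatives. -/
def familyOp {E : Type*} [AddCommGroup E] [Module ℝ E] (k : ℕ) (a : (Fin d → ℕ) → Pt d → ℝ)
    (z : Pt d) (F : (Fin d → ℕ) → Pt d → E) : E :=
  ∑ n ∈ Finset.range (k + 1), ∑ α ∈ Finset.piAntidiag (Finset.univ : Finset (Fin d)) n,
    a α z • F α z

theorem IsPartialFamily.diffOp_eq (hU : IsOpen U) (hF : IsPartialFamily r U F)
    (hf : EqOn f (F 0) U) {k : ℕ} (hk : k ≤ r) {z : Pt d} (hz : z ∈ U)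
    (a : (Fin d → ℕ) → Pt d → ℝ) : diffOp k a f z = familyOp k a z F := by
  refine Finset.sum_congr rfl fun n hn => Finset.sum_congr rfl fun α hα => ?_
  rw [Finset.mem_range] at hn
  rw [Finset.mem_piAntidiag] at hα
  rw [hF.partialDeriv_eq hU hf (hα.1.le.trans (by omega)) hz, smul_eq_mul]

theorem familyOp_congr {E : Type*} [AddCommGroup E] [Module ℝ E] {k : ℕ}
    {a : (Fin d → ℕ) → Pt d → ℝ} {z : Pt d} {F G : (Fin d → ℕ) → Pt d → E}
    (h : ∀ α, ∑ i, α i ≤ k → F α z = G α z) : familyOp k a z F = familyOp k a z G := by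
  refine Finset.sum_congr rfl fun n hn => Finset.sum_congr rfl fun α hα => ?_
  rw [Finset.mem_range] at hn
  rw [Finset.mem_piAntidiag] at hα
  rw [h α (hα.1.le.trans (by omega))]

theorem familyOp_add {E : Type*} [AddCommGroup E] [Module ℝ E] (k : ℕ)
    (a : (Fin d → ℕ) → Pt d → ℝ) (z : Pt d) (F G : (Fin d → ℕ) → Pt d → E) :
    familyOp k a z (fun α y => F α y + G α y) = familyOp k a z F + familyOp k a z G := by
  simp [familyOp, Finset.sum_add_distrib]

theorem familyOp_smul {E : Type*} [AddCommGroup E] [Module ℝ E] (k : ℕ)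
    (a : (Fin d → ℕ) → Pt d → ℝ) (z : Pt d) (c : ℝ) (F : (Fin d → ℕ) → Pt d → E) :
    familyOp k a z (fun α y => c • F α y) = c • familyOp k a z F := by
  simp only [familyOp, Finset.smul_sum]
  refine Finset.sum_congr rfl fun n _ => Finset.sum_congr rfl fun α _ => smul_comm _ _ _

theorem familyOp_sum {E ι : Type*} [AddCommGroup E] [Module ℝ E] (k : ℕ)
    (a : (Fin d → ℕ) → Pt d → ℝ) (z : Pt d) (s : Finset ι) (F : ι → (Fin d → ℕ) → Pt d → E) :
    familyOp k a z (fun α y => ∑ j ∈ s, F j α y) = ∑ j ∈ s, familyOp k a z (F j) := by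
  simp only [familyOp, Finset.smul_sum]
  rw [Finset.sum_comm]
  refine Finset.sum_congr rfl fun n _ => ?_
  rw [Finset.sum_comm]

theorem familyOp_inner {H : Type*} [NormedAddCommGroup H] [InnerProductSpace ℝ H] (k : ℕ)
    (a : (Fin d → ℕ) → Pt d → ℝ) (z : Pt d) (F : (Fin d → ℕ) → Pt d → H) (e : H) :
    familyOp k a z (fun α y => inner ℝ (F α y) e) = inner ℝ (familyOp k a z F) e := by
  simp [familyOp, sum_inner, real_inner_smul_left]

end ScalarFamilies

/-! ### Polynomials and their derivatives -/

section Polynomials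

variable {d : ℕ}

/-- The commutator of two derivations is a derivation, and this one vanishes on the variables. -/
theorem pderiv_comm (i j : Fin d) (p : MvPolynomial (Fin d) ℝ) :
    MvPolynomial.pderiv i (MvPolynomial.pderiv j p) =
      MvPolynomial.pderiv j (MvPolynomial.pderiv i p) := by
  have h : ⁅(MvPolynomial.pderiv i : Derivation ℝ (MvPolynomial (Fin d) ℝ) _),
      (MvPolynomial.pderiv j : Derivation ℝ (MvPolynomial (Fin d) ℝ) _)⁆ = 0 := by
    refine MvPolynomial.derivation_ext (R := ℝ) fun k => ?_
    simp [Derivation.commutator_apply, MvPolynomial.pderiv_X, Pi.single_apply, apply_ite]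
  have := DFunLike.congr_fun h p
  rw [Derivation.commutator_apply] at this
  exact sub_eq_zero.1 this

/-- The partial derivative `∂^α p` of a polynomial. -/
def polyPartial (α : Fin d → ℕ) (p : MvPolynomial (Fin d) ℝ) : MvPolynomial (Fin d) ℝ :=
  (indexList α).foldr (fun i p => MvPolynomial.pderiv i p) p

@[simp] theorem polyPartial_zero (p : MvPolynomial (Fin d) ℝ) : polyPartial 0 p = p := by
  simp [polyPartial]

theorem polyPartial_add_single (α : Fin d → ℕ) (i : Fin d) (p : MvPolynomial (Fin d) ℝ) :
    polyPartial (α + Pi.single i 1) p = MvPolynomial.pderiv i (polyPartial α p) := by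
  have : LeftCommutative (fun (i : Fin d) (p : MvPolynomial (Fin d) ℝ) =>
    MvPolynomial.pderiv i p) := ⟨fun i j p => pderiv_comm i j p⟩
  exact ((cons_indexList_perm α i).foldr_eq p).symm

theorem polyPartial_add (α : Fin d → ℕ) (p p' : MvPolynomial (Fin d) ℝ) :
    polyPartial α (p + p') = polyPartial α p + polyPartial α p' := by
  simp only [polyPartial]
  induction indexList α with
  | nil => rfl
  | cons i l ih => simp [ih]

theorem polyPartial_smul (α : Fin d → ℕ) (c : ℝ) (p : MvPolynomial (Fin d) ℝ) :
    polyPartial α (c • p) = c • polyPartial α p := by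
  simp only [polyPartial]
  induction indexList α with
  | nil => rfl
  | cons i l ih => simp only [List.foldr_cons, ih]; exact Derivation.map_smul _ _ _

theorem polyFun_add (p p' : MvPolynomial (Fin d) ℝ) (x : Pt d) :
    polyFun (p + p') x = polyFun p x + polyFun p' x := by simp [polyFun]

theorem polyFun_smul (c : ℝ) (p : MvPolynomial (Fin d) ℝ) (x : Pt d) :
    polyFun (c • p) x = c * polyFun p x := by simp [polyFun, MvPolynomial.smul_eval]

theorem continuous_polyFun (p : MvPolynomial (Fin d) ℝ) : Continuous (polyFun p) := by
  unfold polyFun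
  exact (MvPolynomial.continuous_eval p).comp (by fun_prop)

theorem hasLineDerivAt_polyFun (p : MvPolynomial (Fin d) ℝ) (y : Pt d) (i : Fin d) :
    HasLineDerivAt ℝ (polyFun p) (polyFun (MvPolynomial.pderiv i p) y) y (coordDir i) := by
  unfold HasLineDerivAt
  induction p using MvPolynomial.induction_on with
  | C c => simpa [polyFun] using hasDerivAt_const (0 : ℝ) c
  | add p q hp hq =>
    simp only [polyFun_add, map_add]
    exact hp.add hq
  | mul_X p j hp =>
    have hX : HasDerivAt (fun t : ℝ => (y + t • coordDir i) j) (if j = i then 1 else 0) 0 := by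
      have := ((hasDerivAt_id (0 : ℝ)).mul_const ((coordDir i : Pt d) j)).const_add (y j)
      simpa [coordDir, Pi.single_apply] using this
    have := hp.mul hX
    simp only [polyFun, map_mul, MvPolynomial.eval_X, MvPolynomial.pderiv_mul,
      MvPolynomial.pderiv_X, map_add] at this ⊢
    refine HasDerivAt.congr_deriv this ?_
    by_cases h : j = i
    · subst h; simp [add_comm]
    · simp [h]

theorem isPartialFamily_poly (r : ℕ) (U : Set (Pt d)) (p : MvPolynomial (Fin d) ℝ) :
    IsPartialFamily r U (fun α => polyFun (polyPartial α p)) :=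
  ⟨fun α _ y _ i => by
    rw [polyPartial_add_single]
    exact hasLineDerivAt_polyFun _ y i, fun α _ => (continuous_polyFun _).continuousOn⟩

theorem polySpace_mono {s t : ℕ} (h : s ≤ t) : polySpace d s ≤ polySpace d t :=
  MvPolynomial.restrictSupport_mono ℝ fun _ hm => lt_of_lt_of_le hm h

theorem pderiv_mem_polySpace {s : ℕ} {p : MvPolynomial (Fin d) ℝ} (hp : p ∈ polySpace d (s + 1))
    (i : Fin d) : MvPolynomial.pderiv i p ∈ polySpace d s := by
  have h1 : polySpace d (s + 1) ≤ (polySpace d s).comap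
      (MvPolynomial.pderiv i : Derivation ℝ (MvPolynomial (Fin d) ℝ) _).toLinearMap := by
    rw [polySpace, MvPolynomial.restrictSupport_eq_span, Submodule.span_le]
    rintro _ ⟨m, hm, rfl⟩
    simp only [Submodule.comap_coe, mem_preimage, SetLike.mem_coe, Derivation.coeFn_coe]
    rw [MvPolynomial.pderiv_monomial, polySpace, MvPolynomial.monomial_mem_restrictSupport]
    by_cases h0 : m i = 0
    · right; simp [h0]
    · left
      have hle : Finsupp.single i 1 ≤ m := by
        rw [Finsupp.single_le_iff]; omega
      have h2 : (m - Finsupp.single i 1).degree + 1 = m.degree := by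
        conv_rhs => rw [← tsub_add_cancel_of_le hle]
        simp [map_add]
      have h3 : m.degree < s + 1 := hm
      show (m - Finsupp.single i 1).degree < s
      omega
  exact h1 hp

theorem polyPartial_mem_polySpace {n s : ℕ} {p : MvPolynomial (Fin d) ℝ} {α : Fin d → ℕ}
    (hp : p ∈ polySpace d (n + s)) (hα : ∑ i, α i = n) : polyPartial α p ∈ polySpace d s := by
  rw [← length_indexList] at hα
  unfold polyPartial
  generalize indexList α = l at hα
  induction l generalizing n s with
  | nil => simp at hα; subst hα; simpa using hp
  | cons i l ih =>
    simp only [List.length_cons] at hα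
    exact pderiv_mem_polySpace (ih (n := l.length) (s := s + 1) (by convert hp using 2; omega) rfl) i

theorem polyFun_eq_of_mem_polySpace_one {p : MvPolynomial (Fin d) ℝ} (hp : p ∈ polySpace d 1)
    (x y : Pt d) : polyFun p x = polyFun p y := by
  have h1 : p = MvPolynomial.C (MvPolynomial.coeff 0 p) := by
    ext m
    rw [MvPolynomial.coeff_C]
    split_ifs with h
    · rw [h]
    · by_contra h2
      have h3 := ((MvPolynomial.mem_restrictSupport_iff ℝ).1 hp) (MvPolynomial.mem_support_iff.2 h2)
      have h4 : m.degree < 1 := h3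
      exact h (((Finsupp.degree_eq_zero_iff m).1 (by omega)).symm)
  rw [h1]; simp [polyFun]

/-- Differentiation of order `m` lowers the degree below `1`. For this reason polynomial terms drop
out of differences of derivatives of order `m`. -/
theorem polyPartial_const {s m : ℕ} {p : MvPolynomial (Fin d) ℝ} (hp : p ∈ polySpace d s)
    (hs : s ≤ m + 1) {α : Fin d → ℕ} (hα : ∑ i, α i = m) (x y : Pt d) :
    polyFun (polyPartial α p) x = polyFun (polyPartial α p) y :=
  polyFun_eq_of_mem_polySpace_one (polyPartial_mem_polySpace (polySpace_mono hs hp) hα) x y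

theorem one_mem_polySpace {q : ℕ} (hq : 0 < q) :
    (1 : MvPolynomial (Fin d) ℝ) ∈ polySpace d q := by
  have : (1 : MvPolynomial (Fin d) ℝ) = MvPolynomial.monomial 0 1 := rfl
  rw [this, polySpace, MvPolynomial.monomial_mem_restrictSupport]
  left
  simpa using hq

end Polynomials

/-! ### Independence of the order of differentiation of the kernel -/

section MixedPartials

variable {d r : ℕ} {U : Set (Pt d)} {K : Pt d → Pt d → ℝ}

theorem HasContinuousPartials.hasLineDerivAt (hK : HasContinuousPartials K r U)
    {c : Fin d ⊕ Fin d} {l : List (Fin d ⊕ Fin d)}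
    (h₁ : (c :: l).countP (fun c => c.isLeft) ≤ r) (h₂ : (c :: l).countP (fun c => c.isRight) ≤ r)
    {p : Pt d × Pt d} (hp : p ∈ U ×ˢ U) :
    HasLineDerivAt ℝ (mixedPartial K l) (mixedPartial K (c :: l) p) p (pairDir c) :=
  ((hK (c :: l) h₁ h₂).2 c l rfl p hp).hasLineDerivAt

/-- A permutation is generated by adjacent swaps, and a swap is the symmetry of continuous second
derivatives. The two bounds on the orders depend only on letter counts, so they survive every
rearrangement. -/
theorem HasContinuousPartials.mixedPartial_perm (hU : IsOpen U) (hK : HasContinuousPartials K r U)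
    {l l' : List (Fin d ⊕ Fin d)} (h : l.Perm l')
    (h₁ : l.countP (fun c => c.isLeft) ≤ r) (h₂ : l.countP (fun c => c.isRight) ≤ r) :
    EqOn (mixedPartial K l) (mixedPartial K l') (U ×ˢ U) := by
  have hW := hU.prod hU
  induction h with
  | nil => exact fun _ _ => rfl
  | @cons c l l' hp ih =>
    intro p hpU
    have := ih (((List.sublist_cons_self c l).countP_le).trans h₁)
      (((List.sublist_cons_self c l).countP_le).trans h₂)
    exact (this.eventuallyEq_of_mem (hW.mem_nhds hpU)).lineDeriv_eq
  | swap c c' l =>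
    intro p hpU
    have e₁ := (List.Perm.swap c c' l).countP_eq (fun c => c.isLeft)
    have e₂ := (List.Perm.swap c c' l).countP_eq (fun c => c.isRight)
    have h₁' := e₁ ▸ h₁
    have h₂' := e₂ ▸ h₂
    have s (c c' : Fin d ⊕ Fin d) := List.sublist_cons_self c' (c :: l)
    exact lineDeriv_comm hW (f := mixedPartial K l)
      (fun p hp => hK.hasLineDerivAt (((s c c').countP_le).trans h₁)
        (((s c c').countP_le).trans h₂) hp)
      (fun p hp => hK.hasLineDerivAt (((s c' c).countP_le).trans h₁')
        (((s c' c).countP_le).trans h₂') hp)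
      (fun p hp => hK.hasLineDerivAt h₁ h₂ hp) (fun p hp => hK.hasLineDerivAt h₁' h₂' hp)
      (hK _ h₁ h₂).1 (hK _ h₁' h₂').1 hpU
  | trans hp hp' ih ih' =>
    have e₁ := hp.countP_eq (fun c => c.isLeft)
    have e₂ := hp.countP_eq (fun c => c.isRight)
    exact (ih h₁ h₂).trans (ih' (e₁ ▸ h₁) (e₂ ▸ h₂))

end MixedPartials

/-! ### Families of mixed partial derivatives in two variables -/

section DoubleFamilies

variable {d : ℕ}

/-- `Q α β x y` is the continuous mixed partial derivative `∂^α_x ∂^β_y (Q 0 0)` on `U × U`, for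
`|α|, |β| ≤ r`. -/
structure IsDoubleFamily (r : ℕ) (U : Set (Pt d))
    (Q : (Fin d → ℕ) → (Fin d → ℕ) → Pt d → Pt d → ℝ) : Prop where
  left : ∀ α β, ∑ i, α i < r → ∑ i, β i ≤ r → ∀ x ∈ U, ∀ y ∈ U, ∀ i,
    HasLineDerivAt ℝ (fun x => Q α β x y) (Q (α + Pi.single i 1) β x y) x (coordDir i)
  right : ∀ α β, ∑ i, α i ≤ r → ∑ i, β i < r → ∀ x ∈ U, ∀ y ∈ U, ∀ i,
    HasLineDerivAt ℝ (fun y => Q α β x y) (Q α (β + Pi.single i 1) x y) y (coordDir i)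
  continuousOn : ∀ α β, ∑ i, α i ≤ r → ∑ i, β i ≤ r →
    ContinuousOn (fun p : Pt d × Pt d => Q α β p.1 p.2) (U ×ˢ U)

variable {r : ℕ} {U : Set (Pt d)} {Q Q' : (Fin d → ℕ) → (Fin d → ℕ) → Pt d → Pt d → ℝ}

theorem IsDoubleFamily.add (hQ : IsDoubleFamily r U Q) (hQ' : IsDoubleFamily r U Q') :
    IsDoubleFamily r U (fun α β x y => Q α β x y + Q' α β x y) :=
  ⟨fun α β hα hβ x hx y hy i =>
      HasDerivAt.add (hQ.left α β hα hβ x hx y hy i) (hQ'.left α β hα hβ x hx y hy i),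
    fun α β hα hβ x hx y hy i =>
      HasDerivAt.add (hQ.right α β hα hβ x hx y hy i) (hQ'.right α β hα hβ x hx y hy i),
    fun α β hα hβ => (hQ.continuousOn α β hα hβ).add (hQ'.continuousOn α β hα hβ)⟩

theorem IsDoubleFamily.sub (hQ : IsDoubleFamily r U Q) (hQ' : IsDoubleFamily r U Q') :
    IsDoubleFamily r U (fun α β x y => Q α β x y - Q' α β x y) :=
  ⟨fun α β hα hβ x hx y hy i =>
      HasDerivAt.sub (hQ.left α β hα hβ x hx y hy i) (hQ'.left α β hα hβ x hx y hy i),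
    fun α β hα hβ x hx y hy i =>
      HasDerivAt.sub (hQ.right α β hα hβ x hx y hy i) (hQ'.right α β hα hβ x hx y hy i),
    fun α β hα hβ => (hQ.continuousOn α β hα hβ).sub (hQ'.continuousOn α β hα hβ)⟩

theorem IsDoubleFamily.sum {ι : Type*} (s : Finset ι)
    {Q : ι → (Fin d → ℕ) → (Fin d → ℕ) → Pt d → Pt d → ℝ}
    (hQ : ∀ j ∈ s, IsDoubleFamily r U (Q j)) :
    IsDoubleFamily r U (fun α β x y => ∑ j ∈ s, Q j α β x y) :=
  ⟨fun α β hα hβ x hx y hy i =>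
      HasDerivAt.fun_sum fun j hj => (hQ j hj).left α β hα hβ x hx y hy i,
    fun α β hα hβ x hx y hy i =>
      HasDerivAt.fun_sum fun j hj => (hQ j hj).right α β hα hβ x hx y hy i,
    fun α β hα hβ => continuousOn_finsetSum _ fun j hj => (hQ j hj).continuousOn α β hα hβ⟩

theorem IsPartialFamily.mul {A B : (Fin d → ℕ) → Pt d → ℝ} (hA : IsPartialFamily r U A)
    (hB : IsPartialFamily r U B) : IsDoubleFamily r U (fun α β x y => A α x * B β y) :=
  ⟨fun α β hα _ x hx y _ i => HasDerivAt.mul_const (hA.1 α hα x hx i) (B β y),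
    fun α β _ hβ x _ y hy i => HasDerivAt.const_mul (A α x) (hB.1 β hβ y hy i),
    fun α β hα hβ => ((hA.2 α hα).comp continuousOn_fst fun _ hp => hp.1).mul
      ((hB.2 β hβ).comp continuousOn_snd fun _ hp => hp.2)⟩

theorem IsDoubleFamily.fst (hQ : IsDoubleFamily r U Q) {y : Pt d} (hy : y ∈ U) :
    IsPartialFamily r U (fun α x => Q α 0 x y) :=
  ⟨fun α hα x hx i => hQ.left α 0 hα (by simp) x hx y hy i,
    fun α hα => (hQ.continuousOn α 0 hα (by simp)).comp
      (f := fun x => (x, y)) (by fun_prop) fun _ hx => ⟨hx, hy⟩⟩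

theorem IsDoubleFamily.snd (hQ : IsDoubleFamily r U Q) {x : Pt d} (hx : x ∈ U) :
    IsPartialFamily r U (fun β y => Q 0 β x y) :=
  ⟨fun β hβ y hy i => hQ.right 0 β (by simp) hβ x hx y hy i,
    fun β hβ => (hQ.continuousOn 0 β (by simp) hβ).comp
      (f := fun y => (x, y)) (by fun_prop) fun _ hy => ⟨hx, hy⟩⟩

/-- A further derivative is prepended to the list, whereas `kernelPartial` uses the sorted list.
`mixedPartial_perm` reconciles the two; in the second argument the new letter has to pass all
derivatives in the first. -/
theorem isDoubleFamily_kernelPartial {K : Pt d → Pt d → ℝ} (hU : IsOpen U)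
    (hK : HasContinuousPartials K r U) :
    IsDoubleFamily r U (fun α β => kernelPartial α β K) := by
  refine ⟨fun α β hα hβ x hx y hy i => ?_, fun α β hα hβ x hx y hy i => ?_, fun α β hα hβ => ?_⟩
  · set l := (indexList α).map Sum.inl ++ (indexList β).map Sum.inr with hl
    have h₁ : (Sum.inl i :: l).countP (fun c => c.isLeft) ≤ r := by
      simp [hl, List.countP_map, Function.comp_def, List.countP_cons]; omega
    have h₂ : (Sum.inl i :: l).countP (fun c => c.isRight) ≤ r := by
      simp [hl, List.countP_map, Function.comp_def]; omega
    have h := hK.hasLineDerivAt h₁ h₂ (p := (x, y)) ⟨hx, hy⟩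
    have hp : (Sum.inl i :: l).Perm
        ((indexList (α + Pi.single i 1)).map Sum.inl ++ (indexList β).map Sum.inr) := by
      have := ((cons_indexList_perm α i).map (Sum.inl (β := Fin d))).append_right
        ((indexList β).map Sum.inr)
      simpa [hl] using this
    rw [hK.mixedPartial_perm hU hp h₁ h₂ ⟨hx, hy⟩] at h
    simpa [HasLineDerivAt, pairDir, kernelPartial] using h
  · set l := (indexList α).map Sum.inl ++ (indexList β).map Sum.inr with hl
    have h₁ : (Sum.inr i :: l).countP (fun c => c.isLeft) ≤ r := by
      simp [hl, List.countP_map, Function.comp_def]; omega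
    have h₂ : (Sum.inr i :: l).countP (fun c => c.isRight) ≤ r := by
      simp [hl, List.countP_map, Function.comp_def, List.countP_cons]; omega
    have h := hK.hasLineDerivAt h₁ h₂ (p := (x, y)) ⟨hx, hy⟩
    have hp : (Sum.inr i :: l).Perm
        ((indexList α).map Sum.inl ++ (indexList (β + Pi.single i 1)).map Sum.inr) := by
      have h3 := ((cons_indexList_perm β i).map (Sum.inr (α := Fin d))).append_left
        ((indexList α).map Sum.inl)
      exact (List.perm_middle (a := Sum.inr i)).symm.trans (by simpa [hl] using h3)
    rw [hK.mixedPartial_perm hU hp h₁ h₂ ⟨hx, hy⟩] at h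
    simpa [HasLineDerivAt, pairDir, kernelPartial] using h
  · refine (hK _ ?_ ?_).1
    · simpa [List.countP_map, Function.comp_def] using hα
    · simpa [List.countP_map, Function.comp_def] using hβ

theorem kernelPartial_zero (K : Pt d → Pt d → ℝ) : kernelPartial 0 0 K = K := by
  ext x y; simp [kernelPartial, mixedPartial, iterLineDeriv]

end DoubleFamilies

/-! ### Higher smoothness of a map from its Gram kernel -/

section Gram

variable {d r : ℕ} {U : Set (Pt d)} {H : Type*} [NormedAddCommGroup H] [InnerProductSpace ℝ H]

/-- Iterated line derivatives of a vector-valued map along coordinate directions. -/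
def vectorPartial (Φ : Pt d → H) : List (Fin d) → Pt d → H
  | [] => Φ
  | i :: l => fun x => lineDeriv ℝ (vectorPartial Φ l) x (coordDir i)

variable {Φ : Pt d → H} {G : (Fin d → ℕ) → (Fin d → ℕ) → Pt d → Pt d → ℝ}

/-- The Gram kernel of the derivatives along `l` is a member of the family `G`. One further
derivative in each argument exists and is continuous, so the first-order criterion applies again. -/
theorem hasLineDerivAt_vectorPartial [CompleteSpace H] (hU : IsOpen U) (hG : IsDoubleFamily r U G)
    {l : List (Fin d)} (hl : l.length < r)
    (h : ∀ x ∈ U, ∀ y ∈ U, inner ℝ (vectorPartial Φ l x) (vectorPartial Φ l y) =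
      G (listIndex l) (listIndex l) x y) (i : Fin d) {x : Pt d} (hx : x ∈ U) :
    HasLineDerivAt ℝ (vectorPartial Φ l) (vectorPartial Φ (i :: l) x) x (coordDir i) := by
  have hl' : ∑ j, listIndex l j < r := by rwa [sum_listIndex]
  obtain ⟨ψ, hψ⟩ := exists_hasLineDerivAt_of_gram hU (Ψ := vectorPartial Φ l) (v := coordDir i)
    (Q₁ := G (listIndex l + Pi.single i 1) (listIndex l))
    (Q₁₁ := G (listIndex l + Pi.single i 1) (listIndex l + Pi.single i 1))
    (fun x hx y hy => hasLineDerivAt_congr_of_eventuallyEq (hG.left _ _ hl' hl'.le x hx y hy i)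
      (by filter_upwards [hU.mem_nhds hx] with x' hx' using h x' hx' y hy))
    (fun x hx y hy => hG.right _ _ (by rw [sum_add_single]; omega) hl' x hx y hy i)
    (hG.continuousOn _ _ (by rw [sum_add_single]; omega) (by rw [sum_add_single]; omega)) hx
  exact hψ.lineDifferentiableAt.hasLineDerivAt

/-- The Gram identity at order `n` makes the derivatives of that order differentiable. The identity
can then be differentiated in the first argument (`h1`) and afterwards in the second, which gives
order `n + 1` in both. -/
theorem inner_vectorPartial [CompleteSpace H] (hU : IsOpen U) (hG : IsDoubleFamily r U G)
    (h : ∀ x ∈ U, ∀ y ∈ U, inner ℝ (Φ x) (Φ y) = G 0 0 x y) (n : ℕ) (hn : n ≤ r) :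
    ∀ l l' : List (Fin d), l.length ≤ n → l'.length ≤ n → ∀ x ∈ U, ∀ y ∈ U,
      inner ℝ (vectorPartial Φ l x) (vectorPartial Φ l' y) =
        G (listIndex l) (listIndex l') x y := by
  induction n with
  | zero =>
    intro l l' hl hl' x hx y hy
    simp only [nonpos_iff_eq_zero, List.length_eq_zero_iff] at hl hl'
    subst hl hl'
    simpa [vectorPartial] using h x hx y hy
  | succ n ih =>
    have ih := ih (by omega)
    have hd : ∀ l : List (Fin d), l.length ≤ n → ∀ i, ∀ x ∈ U, HasLineDerivAt ℝ (vectorPartial Φ l)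
        (vectorPartial Φ (i :: l) x) x (coordDir i) := fun l hl i x hx =>
      hasLineDerivAt_vectorPartial hU hG (by omega) (ih l l hl hl) i hx
    have h1 : ∀ l l' : List (Fin d), l.length ≤ n + 1 → l'.length ≤ n → ∀ x ∈ U, ∀ y ∈ U,
        inner ℝ (vectorPartial Φ l x) (vectorPartial Φ l' y) =
          G (listIndex l) (listIndex l') x y := by
      intro l l' hl hl' x hx y hy
      cases l with
      | nil => exact ih [] l' (by simp) hl' x hx y hy
      | cons i l =>
        simp only [List.length_cons, add_le_add_iff_right] at hl
        have e1 := HasLineDerivAt.inner_const (hd l hl i x hx) (vectorPartial Φ l' y)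
        have e2 := hasLineDerivAt_congr_of_eventuallyEq
          (hG.left (listIndex l) (listIndex l') (by rw [sum_listIndex]; omega)
            (by rw [sum_listIndex]; omega) x hx y hy i)
          (f := fun x => inner ℝ (vectorPartial Φ l x) (vectorPartial Φ l' y))
          (by filter_upwards [hU.mem_nhds hx] with x' hx' using ih l l' hl hl' x' hx' y hy)
        rw [listIndex_cons, ← e1.lineDeriv, ← e2.lineDeriv]
    intro l l' hl hl' x hx y hy
    cases l' with
    | nil => exact h1 l [] hl (by simp) x hx y hy
    | cons i l' =>
      simp only [List.length_cons, add_le_add_iff_right] at hl'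
      have e1 := HasLineDerivAt.inner_const (hd l' hl' i y hy) (vectorPartial Φ l x)
      have e2 := hasLineDerivAt_congr_of_eventuallyEq
        (hG.right (listIndex l) (listIndex l') (by rw [sum_listIndex]; omega)
          (by rw [sum_listIndex]; omega) x hx y hy i)
        (f := fun y => inner ℝ (vectorPartial Φ l' y) (vectorPartial Φ l x))
        (by
          filter_upwards [hU.mem_nhds hy] with y' hy'
          rw [real_inner_comm]
          exact h1 l l' hl hl' x hx y' hy')
      rw [listIndex_cons, real_inner_comm, ← e1.lineDeriv, ← e2.lineDeriv]

theorem eq_of_inner_eq {u v : H} {c : ℝ} (h₁ : inner ℝ u u = c) (h₂ : inner ℝ u v = c)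
    (h₃ : inner ℝ v v = c) : u = v := by
  rw [← sub_eq_zero, ← norm_eq_zero, ← sq_eq_zero_iff, norm_sub_sq_real,
    ← real_inner_self_eq_norm_sq, ← real_inner_self_eq_norm_sq]
  linarith

/-- A map into a Hilbert space whose Gram kernel has continuous mixed partial derivatives up to
the order `r` in each argument is `r` times continuously differentiable. -/
theorem exists_isPartialFamily_of_gram [CompleteSpace H] (hU : IsOpen U)
    (hG : IsDoubleFamily r U G) (h : ∀ x ∈ U, ∀ y ∈ U, inner ℝ (Φ x) (Φ y) = G 0 0 x y) :
    ∃ Ψ : (Fin d → ℕ) → Pt d → H, Ψ 0 = Φ ∧ IsPartialFamily r U Ψ ∧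
      ∀ α β, ∑ i, α i ≤ r → ∑ i, β i ≤ r → ∀ x ∈ U, ∀ y ∈ U,
        inner ℝ (Ψ α x) (Ψ β y) = G α β x y := by
  have hgram : ∀ l l' : List (Fin d), l.length ≤ r → l'.length ≤ r → ∀ x ∈ U, ∀ y ∈ U,
      inner ℝ (vectorPartial Φ l x) (vectorPartial Φ l' y) =
        G (listIndex l) (listIndex l') x y := inner_vectorPartial hU hG h r le_rfl
  have hgram' : ∀ α β, ∑ i, α i ≤ r → ∑ i, β i ≤ r → ∀ x ∈ U, ∀ y ∈ U,
        inner ℝ (vectorPartial Φ (indexList α) x) (vectorPartial Φ (indexList β) y) =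
          G α β x y := fun α β hα hβ x hx y hy => by
    have := hgram (indexList α) (indexList β) (by simpa) (by simpa) x hx y hy
    rwa [listIndex_indexList, listIndex_indexList] at this
  refine ⟨fun α => vectorPartial Φ (indexList α), by simp [vectorPartial], ⟨?_, ?_⟩, hgram'⟩
  · intro α hα y hy i
    have h1 := hasLineDerivAt_vectorPartial hU hG (l := indexList α) (by simpa)
      (fun x hx y hy => hgram _ _ (by simpa using hα.le) (by simpa using hα.le) x hx y hy) i hy
    have hl : (i :: indexList α).length ≤ r := by simpa using hα
    have hα' : (indexList (α + Pi.single i 1)).length ≤ r := by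
      rw [length_indexList, sum_add_single]; omega
    -- The two lists differ only in order, but symmetry of derivatives is not yet known for
    -- vector-valued maps. Equal Gram entries force the two vectors to coincide.
    have h2 : vectorPartial Φ (i :: indexList α) y =
        vectorPartial Φ (indexList (α + Pi.single i 1)) y := by
      refine eq_of_inner_eq (hgram _ _ hl hl y hy y hy) ?_ ?_
      · rw [hgram _ _ hl hα' y hy y hy, listIndex_cons, listIndex_indexList, listIndex_indexList]
      · rw [hgram _ _ hα' hα' y hy y hy, listIndex_cons, listIndex_indexList, listIndex_indexList]
    rwa [h2] at h1
  · intro α hα x hx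
    rw [ContinuousWithinAt, tendsto_iff_norm_sub_tendsto_zero]
    have hc := hG.continuousOn α α hα hα
    -- This is `‖Ψ α y - Ψ α x‖²` expanded through the Gram kernel. Its limit is `0`.
    have c1 : Tendsto (fun y => G α α y y - 2 * G α α y x + G α α x x) (𝓝[U] x)
        (𝓝 (G α α x x - 2 * G α α x x + G α α x x)) := by
      have t1 : Tendsto (fun y => G α α y y) (𝓝[U] x) (𝓝 (G α α x x)) :=
        (hc.comp (f := fun y => (y, y)) (by fun_prop) fun _ hy => ⟨hy, hy⟩) x hx
      have t2 : Tendsto (fun y => G α α y x) (𝓝[U] x) (𝓝 (G α α x x)) :=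
        (hc.comp (f := fun y => (y, x)) (by fun_prop) fun _ hy => ⟨hy, hx⟩) x hx
      exact (t1.sub (t2.const_mul 2)).add_const _
    have c2 := (Real.continuous_sqrt.tendsto _).comp c1
    have e : G α α x x - 2 * G α α x x + G α α x x = 0 := by ring
    rw [e, Real.sqrt_zero] at c2
    refine c2.congr' ?_
    filter_upwards [self_mem_nhdsWithin] with y hy
    simp only [Function.comp_def]
    rw [← Real.sqrt_sq (norm_nonneg (vectorPartial Φ (indexList α) y - _)), norm_sub_sq_real,
      ← real_inner_self_eq_norm_sq, ← real_inner_self_eq_norm_sq, hgram' α α hα hα y hy y hy,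
      hgram' α α hα hα y hy x hx, hgram' α α hα hα x hx x hx]

end Gram

/-! ### Multinomial recursion for directional derivatives -/

section Multinomial

variable {d : ℕ}

/-- The coefficient of `∂^α` in the `|α|`-th directional derivative along `h`. -/
def dirCoeff (h : Fin d → ℝ) (α : Fin d → ℕ) : ℝ :=
  (Nat.multinomial Finset.univ α : ℝ) * ∏ i, h i ^ α i

theorem pow_sum_monomial (h : Fin d → ℝ) (n : ℕ) :
    (∑ i, MvPolynomial.monomial (Finsupp.single i 1) (h i)) ^ n =
      ∑ α ∈ Finset.piAntidiag (Finset.univ : Finset (Fin d)) n,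
        MvPolynomial.monomial (Finsupp.equivFunOnFinite.symm α) (dirCoeff h α) := by
  rw [Finset.sum_pow_eq_sum_piAntidiag]
  refine Finset.sum_congr rfl fun α _ => ?_
  have h1 : ∏ i, MvPolynomial.monomial (Finsupp.single i 1) (h i) ^ α i =
      MvPolynomial.monomial (Finsupp.equivFunOnFinite.symm α) (∏ i, h i ^ α i) := by
    simp_rw [← MvPolynomial.C_mul_X_eq_monomial, mul_pow, Finset.prod_mul_distrib]
    rw [MvPolynomial.monomial_eq, Finsupp.prod_fintype _ _ (by simp)]
    simp
  rw [h1, dirCoeff, ← MvPolynomial.C_mul_monomial]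
  simp

/-- Monomials serve as formal symbols for derivatives. The identity is the image of `P ^ (n + 1) = P
^ n * P`, with `P = ∑ h_i X_i`, under the linear map sending the monomial of exponent `α` to `ψ α`.
-/
theorem sum_piAntidiag_succ {E : Type*} [AddCommGroup E] [Module ℝ E] (h : Fin d → ℝ)
    (ψ : (Fin d → ℕ) → E) (n : ℕ) :
    ∑ α ∈ Finset.piAntidiag (Finset.univ : Finset (Fin d)) (n + 1), dirCoeff h α • ψ α =
      ∑ α ∈ Finset.piAntidiag (Finset.univ : Finset (Fin d)) n,
        dirCoeff h α • ∑ i, h i • ψ (α + Pi.single i 1) := by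
  let L : MvPolynomial (Fin d) ℝ →ₗ[ℝ] E :=
    (MvPolynomial.basisMonomials (Fin d) ℝ).constr ℝ (fun m => ψ m)
  have hL : ∀ m c, L (MvPolynomial.monomial m c) = c • ψ m := by
    intro m c
    have h1 : MvPolynomial.monomial m c = c • MvPolynomial.basisMonomials (Fin d) ℝ m := by
      simp [MvPolynomial.smul_monomial]
    rw [h1, map_smul, Module.Basis.constr_basis]
  have h1 := congrArg L (pow_succ (∑ i, MvPolynomial.monomial (Finsupp.single i 1) (h i)) n)
  rw [pow_sum_monomial, pow_sum_monomial, Finset.sum_mul_sum] at h1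
  simp only [map_sum, MvPolynomial.monomial_mul, hL] at h1
  simp only [Finset.smul_sum, smul_smul]
  have he : ∀ (α : Fin d → ℕ) (i : Fin d), α + Pi.single i 1 =
      ((Finsupp.equivFunOnFinite.symm α + Finsupp.single i 1 : Fin d →₀ ℕ) : Fin d → ℕ) := fun α i => by
    ext j
    simp [Finsupp.single_apply, Pi.single_apply, eq_comm]
  simp only [he]
  exact h1

end Multinomial

/-! ### Taylor estimates along segments -/

section Taylor

variable {d m : ℕ} {U : Set (Pt d)} {E : Type*} [NormedAddCommGroup E] [NormedSpace ℝ E]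
  {ψ : (Fin d → ℕ) → Pt d → E}

/-- The `n`-th derivative of `t ↦ ψ 0 (z + t h)`. -/
def dirDeriv (ψ : (Fin d → ℕ) → Pt d → E) (z h : Pt d) (n : ℕ) (t : ℝ) : E :=
  ∑ α ∈ Finset.piAntidiag (Finset.univ : Finset (Fin d)) n, dirCoeff h α • ψ α (z + t • h)

theorem hasDerivAt_dirDeriv (hU : IsOpen U) (hψ : IsPartialFamily m U ψ) {n : ℕ} (hn : n < m)
    {z h : Pt d} {t : ℝ} (ht : z + t • h ∈ U) :
    HasDerivAt (dirDeriv ψ z h n) (dirDeriv ψ z h (n + 1) t) t := by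
  unfold dirDeriv
  rw [sum_piAntidiag_succ h (fun α => ψ α (z + t • h))]
  refine HasDerivAt.fun_sum fun α hα => HasDerivAt.const_smul _ ?_
  rw [Finset.mem_piAntidiag] at hα
  exact hasDerivAt_comp_line (hψ.hasLineDerivAt_dir hU (hα.1.le.trans_lt hn) ht h)

theorem dirDeriv_zero (ψ : (Fin d → ℕ) → Pt d → E) (z h : Pt d) (t : ℝ) :
    dirDeriv ψ z h 0 t = ψ 0 (z + t • h) := by
  simp [dirDeriv, dirCoeff, Nat.multinomial]

/-- Induction downwards from order `m`. The derivative of order `m - (j + 1)` vanishes at `0`, and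
integrating the bound on its own derivative gains one power of `t` and one factor of the factorial.
-/
theorem norm_dirDeriv_le (hU : IsOpen U) (hψ : IsPartialFamily m U ψ) {z h : Pt d}
    (hseg : ∀ t ∈ Icc (0 : ℝ) 1, z + t • h ∈ U) (h0 : ∀ α, ∑ i, α i ≤ m → ψ α z = 0) {C : ℝ}
    (hC : ∀ t ∈ Icc (0 : ℝ) 1, ‖dirDeriv ψ z h m t‖ ≤ C * t) (j : ℕ) (hj : j ≤ m) :
    ∀ t ∈ Icc (0 : ℝ) 1,
      ‖dirDeriv ψ z h (m - j) t‖ ≤ C / (j + 1).factorial * t ^ (j + 1) := by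
  induction j with
  | zero => simpa using hC
  | succ j ih =>
    have ih := ih (by omega)
    have hd : ∀ t ∈ Icc (0 : ℝ) 1, HasDerivAt (dirDeriv ψ z h (m - (j + 1)))
        (dirDeriv ψ z h (m - j) t) t := fun t ht => by
      have := hasDerivAt_dirDeriv hU hψ (n := m - (j + 1)) (by omega) (hseg t ht)
      rwa [show m - (j + 1) + 1 = m - j by omega] at this
    have hf : ((j + 1 + 1).factorial : ℝ) = (j + 1 + 1) * (j + 1).factorial := by
      rw [Nat.factorial_succ]; push_cast; ring
    refine image_norm_le_of_norm_deriv_right_le_deriv_boundary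
      (f' := dirDeriv ψ z h (m - j)) (B' := fun t => C / (j + 1).factorial * t ^ (j + 1))
      (fun t ht => (hd t ht).continuousAt.continuousWithinAt)
      (fun t ht => (hd t (Ico_subset_Icc_self ht)).hasDerivWithinAt) ?_ ?_
      (fun t ht => ih t (Ico_subset_Icc_self ht))
    · have : dirDeriv ψ z h (m - (j + 1)) 0 = 0 := by
        refine Finset.sum_eq_zero fun α hα => ?_
        rw [Finset.mem_piAntidiag] at hα
        rw [zero_smul, add_zero, h0 α (hα.1.le.trans (by omega)), smul_zero]
      rw [this]; simp
    · intro t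
      have := (hasDerivAt_pow (j + 1 + 1) t).const_mul (C / ((j + 1 + 1).factorial : ℝ))
      refine this.congr_deriv ?_
      rw [hf]
      have h2 : ((j + 1).factorial : ℝ) ≠ 0 := by positivity
      have h3 : ((j : ℝ) + 1 + 1) ≠ 0 := by positivity
      simp only [Nat.add_sub_cancel]
      push_cast
      field_simp

theorem norm_le_of_norm_dirDeriv_le (hU : IsOpen U) (hψ : IsPartialFamily m U ψ) {z h : Pt d}
    (hseg : ∀ t ∈ Icc (0 : ℝ) 1, z + t • h ∈ U) (h0 : ∀ α, ∑ i, α i ≤ m → ψ α z = 0) {C : ℝ}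
    (hC : ∀ t ∈ Icc (0 : ℝ) 1, ‖dirDeriv ψ z h m t‖ ≤ C * t) :
    ‖ψ 0 (z + h)‖ ≤ C / (m + 1).factorial := by
  have := norm_dirDeriv_le hU hψ hseg h0 hC m le_rfl 1 (by simp)
  simpa [dirDeriv_zero] using this

/-- Differentiable maps are Lipschitz along a segment on which the first derivatives are
bounded. -/
theorem norm_sub_le_of_norm_partials_le {r : ℕ} (hU : IsOpen U) (hψ : IsPartialFamily r U ψ)
    {α : Fin d → ℕ} (hα : ∑ i, α i < r) {z h : Pt d}
    (hseg : ∀ t ∈ Icc (0 : ℝ) 1, z + t • h ∈ U) {C : ℝ}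
    (hC : ∀ t ∈ Icc (0 : ℝ) 1, ∑ i, ‖ψ (α + Pi.single i 1) (z + t • h)‖ ≤ C) :
    ‖ψ α (z + h) - ψ α z‖ ≤ C * ‖h‖ := by
  have hd : ∀ t ∈ Icc (0 : ℝ) 1, HasDerivAt (fun t : ℝ => ψ α (z + t • h))
      (∑ i, h i • ψ (α + Pi.single i 1) (z + t • h)) t := fun t ht =>
    hasDerivAt_comp_line (hψ.hasLineDerivAt_dir hU hα (hseg t ht) h)
  have := norm_image_sub_le_of_norm_deriv_le_segment_01' (C := C * ‖h‖)
    (fun t ht => (hd t ht).hasDerivWithinAt) (fun t ht => by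
      have ht' := Ico_subset_Icc_self ht
      calc ‖∑ i, h i • ψ (α + Pi.single i 1) (z + t • h)‖
          ≤ ∑ i, ‖ψ (α + Pi.single i 1) (z + t • h)‖ * ‖h‖ := by
            refine norm_sum_le_of_le _ fun i _ => ?_
            rw [norm_smul, mul_comm]
            gcongr
            exact PiLp.norm_apply_le h i
        _ ≤ C * ‖h‖ := by
            rw [← Finset.sum_mul]
            gcongr
            exact hC t ht')
  simpa using this

end Taylor

/-! ### Existence of Taylor polynomials -/

section TaylorPolynomial

variable {d : ℕ}

/-- The Taylor estimate with `C = 0`: derivatives of order `m` are constant, so they vanish along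
every segment from `z`. -/
theorem eq_zero_of_polyPartial_eq_zero {m : ℕ} {p : MvPolynomial (Fin d) ℝ}
    (hp : p ∈ polySpace d (m + 1)) (z : Pt d)
    (h0 : ∀ α : Fin d → ℕ, ∑ i, α i ≤ m → polyFun (polyPartial α p) z = 0) : p = 0 := by
  apply MvPolynomial.funext
  intro y
  have h1 := norm_le_of_norm_dirDeriv_le (isOpen_univ) (isPartialFamily_poly m univ p)
    (z := z) (h := WithLp.toLp 2 y - z) (C := 0) (by simp) h0 (fun t _ => by
      rw [zero_mul, norm_le_zero_iff]
      refine Finset.sum_eq_zero fun α hα => ?_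
      rw [Finset.mem_piAntidiag] at hα
      simp only [polyPartial_const hp le_rfl hα.1 _ z, h0 α hα.1.le, smul_zero])
  simpa [polyFun] using h1

/-- There is a polynomial of degree less than `q` with prescribed partial derivatives of order
less than `q` at `z`. -/
theorem exists_taylor_polynomial (q : ℕ) (z : Pt d) (c : (Fin d → ℕ) → ℝ) :
    ∃ T ∈ polySpace d q, ∀ α : Fin d → ℕ, ∑ i, α i < q → polyFun (polyPartial α T) z = c α := by
  obtain _ | m := q
  · exact ⟨0, zero_mem _, by simp⟩
  let I := {m' : Fin d →₀ ℕ | m'.degree < m + 1}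
  have : Finite I := (Finsupp.finite_of_degree_lt (m + 1)).to_subtype
  have : Fintype I := Fintype.ofFinite I
  let b : Module.Basis I ℝ (polySpace d (m + 1)) := MvPolynomial.basisRestrictSupport ℝ I
  have : FiniteDimensional ℝ (polySpace d (m + 1)) := b.finiteDimensional_of_finite
  let L : polySpace d (m + 1) →ₗ[ℝ] (I → ℝ) :=
    { toFun := fun p i => polyFun (polyPartial (i : Fin d →₀ ℕ) (p : MvPolynomial (Fin d) ℝ)) z
      map_add' := fun p p' => by ext i; simp [polyPartial_add, polyFun_add]
      map_smul' := fun c p => by ext i; simp [polyPartial_smul, polyFun_smul] }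
  have hI : ∀ α : Fin d → ℕ, ∑ i, α i < m + 1 → Finsupp.equivFunOnFinite.symm α ∈ I := by
    intro α hα
    show (Finsupp.equivFunOnFinite.symm α).degree < m + 1
    simpa [Finsupp.degree_eq_sum] using hα
  have hval : ∀ (p : polySpace d (m + 1)) (α : Fin d → ℕ) (hα : ∑ i, α i < m + 1),
      polyFun (polyPartial α (p : MvPolynomial (Fin d) ℝ)) z = L p ⟨_, hI α hα⟩ :=
    fun p α hα => rfl
  have hinj : Function.Injective L := by
    rw [← LinearMap.ker_eq_bot, LinearMap.ker_eq_bot']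
    intro p hp
    apply Subtype.ext
    refine eq_zero_of_polyPartial_eq_zero p.2 z fun α hα => ?_
    rw [hval p α (by omega), hp]; rfl
  -- Both sides have dimension `#I`: the same exponents index the monomial basis and the derivatives
  -- at `z`.
  have hsurj : Function.Surjective L :=
    (LinearMap.injective_iff_surjective_of_finrank_eq_finrank (by
      rw [Module.finrank_eq_card_basis b, Module.finrank_fintype_fun_eq_card])).1 hinj
  obtain ⟨p, hp⟩ := hsurj (fun i => c (i : Fin d →₀ ℕ))
  refine ⟨p, p.2, fun α hα => ?_⟩
  rw [hval p α hα, hp]; rfl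

end TaylorPolynomial

/-! ### Interpolation nodes and saddle point systems -/

section LinearAlgebra

/-- Every vector is evaluated by finitely many of a family of functionals on a finite-dimensional
space. -/
theorem exists_interpolation {ι V : Type*} [AddCommGroup V] [Module ℝ V] [FiniteDimensional ℝ V]
    (ev : ι → V →ₗ[ℝ] ℝ) (U : Set ι) :
    ∃ X : Finset ι, ↑X ⊆ U ∧ ∃ ℓ : X → V, ∀ y ∈ U, ∀ p : V,
      ev y p = ∑ ξ : X, ev ξ p * ev y (ℓ ξ) := by
  classical
  have hfg : (Submodule.span ℝ (ev '' U)).FG := IsNoetherian.noetherian _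
  obtain ⟨t, htU, ht⟩ := Submodule.fg_span_iff_fg_span_finset_subset (ev '' U) |>.1 hfg
  obtain ⟨X, hX, rfl⟩ := Finset.subset_set_image_iff.1 htU
  refine ⟨X, hX, ?_⟩
  have hker : ∀ p : V, (∀ ξ ∈ X, ev ξ p = 0) → ∀ y ∈ U, ev y p = 0 := by
    intro p hp y hy
    have h1 : ev y ∈ Submodule.span ℝ ((X.image ev : Finset (V →ₗ[ℝ] ℝ)) : Set (V →ₗ[ℝ] ℝ)) :=
      ht ▸ Submodule.subset_span (mem_image_of_mem ev hy)
    have h2 : Submodule.span ℝ ((X.image ev : Finset (V →ₗ[ℝ] ℝ)) : Set (V →ₗ[ℝ] ℝ)) ≤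
        LinearMap.ker (Module.Dual.eval ℝ V p) := by
      rw [Submodule.span_le]
      intro f hf
      simp only [Finset.coe_image, mem_image, Finset.mem_coe] at hf
      obtain ⟨ξ, hξ, rfl⟩ := hf
      exact hp ξ hξ
    exact h2 h1
  let T : V →ₗ[ℝ] (X → ℝ) := LinearMap.pi fun ξ => ev ξ
  -- `S` extends a linear right inverse of `T` from its range, so `T S T = T`. Thus `p` and `S (T
  -- p)` agree at the chosen nodes, and then on all of `U` by `hker`.
  obtain ⟨g, hg⟩ := T.rangeRestrict.exists_rightInverse_of_surjective T.range_rangeRestrict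
  obtain ⟨S, hS⟩ := g.exists_extend
  refine ⟨fun ξ => S (Pi.single ξ 1), fun y hy p => ?_⟩
  have h1 : T (S (T p)) = T p := by
    have e1 : S (T p) = g (T.rangeRestrict p) :=
      LinearMap.congr_fun hS (T.rangeRestrict p)
    have e2 := LinearMap.congr_fun hg (T.rangeRestrict p)
    rw [e1]
    exact congrArg Subtype.val e2
  have h2 : ev y (p - S (T p)) = 0 := by
    refine hker _ (fun ξ hξ => ?_) y hy
    have := congrFun h1 ⟨ξ, hξ⟩
    rw [map_sub, sub_eq_zero]
    exact this.symm
  have h3 : S (T p) = ∑ ξ : X, ev ξ p • S (Pi.single ξ 1) := by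
    conv_lhs => rw [← Finset.univ_sum_single (T p)]
    rw [map_sum]
    refine Finset.sum_congr rfl fun ξ _ => ?_
    rw [← map_smul]
    congr 1
    ext ξ'
    simp [Pi.single_apply, T]
  rw [map_sub, sub_eq_zero] at h2
  rw [h2, h3, map_sum]
  simp

/-- Existence and uniqueness for the saddle point system of a form that is positive definite on
the kernel of the constraints. -/
theorem existsUnique_saddle {n m : ℕ} (A : Fin n → Fin n → ℝ) (P : Fin n → Fin m → ℝ)
    (hA : ∀ u : Fin n → ℝ, (∀ l, ∑ i, u i * P i l = 0) → u ≠ 0 →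
      0 < ∑ i, ∑ j, u i * u j * A i j)
    (b : Fin n → ℝ) (c : Fin m → ℝ) (hc : ∃ w : Fin n → ℝ, ∀ l, ∑ j, w j * P j l = c l) :
    ∃! w : Fin n → ℝ, (∃ v : Fin m → ℝ, ∀ i, ∑ j, w j * A i j + ∑ l, v l * P i l = b i) ∧
      ∀ l, ∑ j, w j * P j l = c l := by
  classical
  have hA0 : ∀ u : Fin n → ℝ, (∀ l, ∑ i, u i * P i l = 0) →
      ∑ i, u i * ∑ j, u j * A i j = 0 → u = 0 := by
    intro u hu h0
    by_contra hne
    have := hA u hu hne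
    simp only [Finset.mul_sum, ← mul_assoc] at h0
    exact this.ne' h0
  obtain ⟨w₀, hw₀⟩ := hc
  let f : Fin m → (Fin n → ℝ) →ₗ[ℝ] ℝ := fun l =>
    ∑ i, (P i l) • (LinearMap.proj i : (Fin n → ℝ) →ₗ[ℝ] ℝ)
  have hf : ∀ l t, f l t = ∑ i, t i * P i l := fun l t => by
    simp [f, LinearMap.sum_apply, mul_comm]
  let Z : Submodule ℝ (Fin n → ℝ) := ⨅ l, LinearMap.ker (f l)
  have hZ : ∀ t, t ∈ Z ↔ ∀ l, ∑ i, t i * P i l = 0 := fun t => by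
    simp [Z, Submodule.mem_iInf, hf]
  let B : (Fin n → ℝ) →ₗ[ℝ] (Fin n → ℝ) →ₗ[ℝ] ℝ :=
    LinearMap.mk₂ ℝ (fun u t => ∑ i, t i * ∑ j, u j * A i j)
      (fun u u' t => by simp [add_mul, mul_add, Finset.sum_add_distrib])
      (fun a u t => by
        simp only [Pi.smul_apply, smul_eq_mul, Finset.mul_sum]
        exact Finset.sum_congr rfl fun i _ => Finset.sum_congr rfl fun j _ => by ring)
      (fun u t t' => by simp [add_mul, Finset.sum_add_distrib])
      (fun a u t => by simp [Finset.mul_sum, mul_assoc])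
  let φ : Z →ₗ[ℝ] Module.Dual ℝ Z := (B.compl₁₂ Z.subtype Z.subtype)
  have hφ : Function.Injective φ := by
    rw [← LinearMap.ker_eq_bot, LinearMap.ker_eq_bot']
    intro u hu
    apply Subtype.ext
    exact hA0 u ((hZ u).1 u.2) (LinearMap.congr_fun hu u)
  have hφs : Function.Surjective φ :=
    (LinearMap.injective_iff_surjective_of_finrank_eq_finrank
      Subspace.dual_finrank_eq.symm).1 hφ
  let β : (Fin n → ℝ) →ₗ[ℝ] ℝ := ∑ i, b i • (LinearMap.proj i : (Fin n → ℝ) →ₗ[ℝ] ℝ)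
  -- The form is nondegenerate on `Z`, so `w₀` can be corrected within `Z` until the residual `β - B
  -- (w₀ + u)` vanishes on `Z`. It is then a combination of the constraints, with coefficients `v`.
  obtain ⟨u, hu⟩ := hφs ((β - B w₀).comp Z.subtype)
  have hres : Z ≤ LinearMap.ker (β - B (w₀ + u)) := by
    intro t ht
    have h1 : B u t = (β - B w₀) t := LinearMap.congr_fun hu ⟨t, ht⟩
    rw [LinearMap.mem_ker, map_add, LinearMap.sub_apply, LinearMap.add_apply, h1,
      LinearMap.sub_apply]
    ring
  have hspan := mem_span_of_iInf_ker_le_ker hres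
  obtain ⟨v, hv⟩ := (Submodule.mem_span_range_iff_exists_fun ℝ).1 hspan
  refine ⟨w₀ + u, ⟨⟨v, fun i => ?_⟩, fun l => ?_⟩, ?_⟩
  · have h1 := LinearMap.congr_fun hv (Pi.single i 1)
    simp only [LinearMap.sum_apply, LinearMap.smul_apply, hf, LinearMap.sub_apply, smul_eq_mul,
      Pi.single_apply, ite_mul, one_mul, zero_mul, Finset.sum_ite_eq', Finset.mem_univ, if_true,
      LinearMap.mk₂_apply, B, β, LinearMap.proj_apply, mul_ite, mul_one, mul_zero] at h1
    rw [h1]; simp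
  · have := (hZ u).1 u.2 l
    simp [add_mul, Finset.sum_add_distrib, hw₀ l, this]
  · rintro w ⟨⟨v', hv'⟩, hw⟩
    have hu' : ∀ l, ∑ i, (w - (w₀ + u)) i * P i l = 0 := fun l => by
      have := (hZ u).1 u.2 l
      simp [sub_mul, add_mul, Finset.sum_add_distrib, Finset.sum_sub_distrib, hw l, hw₀ l, this]
    have hdiff : ∀ i, ∑ j, (w - (w₀ + u)) j * A i j = ∑ l, (v l - v' l) * P i l := by
      intro i
      have h1 := LinearMap.congr_fun hv (Pi.single i 1)
      simp only [LinearMap.sum_apply, LinearMap.smul_apply, hf, LinearMap.sub_apply, smul_eq_mul,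
        Pi.single_apply, ite_mul, one_mul, zero_mul, Finset.sum_ite_eq', Finset.mem_univ, if_true,
        LinearMap.mk₂_apply, B, β, LinearMap.proj_apply, mul_ite, mul_one, mul_zero] at h1
      have h2 := hv' i
      simp only [sub_mul, Finset.sum_sub_distrib, Pi.sub_apply]
      linarith
    -- The difference of two solutions lies in `Z`, and its image under `A` is a combination of
    -- constraint columns. Pairing the two gives zero.
    have := hA0 (w - (w₀ + u)) hu' (by
      simp only [hdiff, Finset.mul_sum]
      rw [Finset.sum_comm]
      refine Finset.sum_eq_zero fun l _ => ?_
      have h3 := hu' l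
      calc ∑ i, (w - (w₀ + u)) i * ((v l - v' l) * P i l)
          = (v l - v' l) * ∑ i, (w - (w₀ + u)) i * P i l := by
            rw [Finset.mul_sum]
            exact Finset.sum_congr rfl fun i _ => by ring
        _ = 0 := by rw [h3, mul_zero])
    exact sub_eq_zero.1 this

end LinearAlgebra

/-! ### Duality between growth function and exact weights -/

section Duality

variable {N : ℕ} {V : Type*} [AddCommGroup V] [Module ℝ V]

/-- Homogeneity. Scaling by `μ + ε` instead of `μ`, followed by `ε → 0`, covers `μ = 0`. -/
theorem le_mul_of_forall_le {T : V →ₗ[ℝ] (Fin N → ℝ)} {L : V →ₗ[ℝ] ℝ} {δ : Fin N → ℝ}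
    (hδ : ∀ j, 0 ≤ δ j) {ρ : ℝ} (hρ : ∀ p, (∀ j, |T p j| ≤ δ j) → L p ≤ ρ) {μ : ℝ} (hμ : 0 ≤ μ)
    {p : V} (hp : ∀ j, |T p j| ≤ μ * δ j) : L p ≤ ρ * μ := by
  have h1 : ∀ ε > 0, L p ≤ ρ * (μ + ε) := by
    intro ε hε
    have hpos : 0 < μ + ε := by linarith
    have := hρ ((μ + ε)⁻¹ • p) (fun j => by
      rw [map_smul, Pi.smul_apply, smul_eq_mul, abs_mul, abs_of_pos (inv_pos.2 hpos),
        inv_mul_le_iff₀ hpos]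
      exact (hp j).trans (by gcongr; exact hδ j; linarith))
    rw [map_smul, smul_eq_mul, inv_mul_le_iff₀ hpos] at this
    linarith
  have h2 : Tendsto (fun ε : ℝ => ρ * (μ + ε)) (𝓝[>] 0) (𝓝 (ρ * (μ + 0))) := by
    have : Continuous (fun ε : ℝ => ρ * (μ + ε)) := by fun_prop
    exact (this.tendsto 0).mono_left nhdsWithin_le_nhds
  rw [add_zero] at h2
  exact ge_of_tendsto h2 (by filter_upwards [self_mem_nhdsWithin] with ε hε using h1 ε hε)

/-- Duality between the growth function and the minimal weighted `ℓ₁`-norm of exact weights. -/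
theorem exists_weights {T : V →ₗ[ℝ] (Fin N → ℝ)} {L : V →ₗ[ℝ] ℝ} {δ : Fin N → ℝ}
    (hδ : ∀ j, 0 ≤ δ j) (hδ' : ∀ i j, δ i = 0 → δ j = 0 → i = j) {e : V} (he : ∀ j, T e j = 1)
    {ρ : ℝ} (hρ : ∀ p, (∀ j, |T p j| ≤ δ j) → L p ≤ ρ) :
    ∃ w : Fin N → ℝ, (∀ p, ∑ j, w j * T p j = L p) ∧ ∑ j, |w j| * δ j ≤ ρ := by
  classical
  have hρ0 : 0 ≤ ρ := by simpa using hρ 0 (by simpa using hδ)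
  -- Because `0⁻¹ = 0`, `D` ignores a coordinate with `δ j = 0`. The functional `τ` reads off that
  -- coordinate, and is zero if there is none.
  let D : (Fin N → ℝ) →ₗ[ℝ] (Fin N → ℝ) :=
    LinearMap.pi fun j => (δ j)⁻¹ • (LinearMap.proj j : (Fin N → ℝ) →ₗ[ℝ] ℝ)
  have hD : ∀ y j, D y j = (δ j)⁻¹ * y j := fun y j => rfl
  let τ : (Fin N → ℝ) →ₗ[ℝ] ℝ :=
    ∑ j, (if δ j = 0 then (1 : ℝ) else 0) • (LinearMap.proj j : (Fin N → ℝ) →ₗ[ℝ] ℝ)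
  have hτ : ∀ y, τ y = ∑ j, if δ j = 0 then y j else 0 := fun y => by
    simp only [τ, LinearMap.sum_apply, LinearMap.smul_apply, LinearMap.proj_apply, smul_eq_mul,
      ite_mul, one_mul, zero_mul]
  have hτ' : ∀ y j, δ j = 0 → τ y = y j := fun y j hj => by
    rw [hτ, Finset.sum_eq_single j]
    · simp [hj]
    · intro i _ hij
      rw [if_neg fun hi => hij (hδ' i j hi hj)]
    · simp
  set C := ρ * ‖D (T e)‖ + |L e| with hC
  -- The first term is the natural sublinear majorant. The second pays for replacing `p` by `p - τ(T
  -- p) e`, which vanishes at the coordinate with `δ j = 0`. This accounts for the value of `C`.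
  let S : (Fin N → ℝ) → ℝ := fun y => ρ * ‖D y‖ + C * |τ y|
  have hS : ∀ p, L p ≤ S (T p) := by
    intro p
    have h1 : L (p - τ (T p) • e) ≤ ρ * (‖D (T p)‖ + |τ (T p)| * ‖D (T e)‖) := by
      refine le_mul_of_forall_le hδ hρ (by positivity) fun j => ?_
      rw [map_sub, map_smul]
      simp only [Pi.sub_apply, Pi.smul_apply, he, smul_eq_mul, mul_one]
      rcases (hδ j).eq_or_lt with h0 | hpos
      · rw [hτ' (T p) j h0.symm]; simp [← h0]
      · have a1 : |T p j| = |D (T p) j| * δ j := by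
          rw [hD, abs_mul, abs_of_pos (inv_pos.2 hpos)]; field_simp
        have a2 : 1 = |D (T e) j| * δ j := by
          rw [hD, he, abs_mul, abs_of_pos (inv_pos.2 hpos)]; field_simp; simp
        calc |T p j - τ (T p)| ≤ |T p j| + |τ (T p)| * 1 := by
              rw [mul_one]; exact abs_sub _ _
          _ = (|D (T p) j| + |τ (T p)| * |D (T e) j|) * δ j := by
              rw [a1]; nth_rewrite 1 [a2]; ring
          _ ≤ _ := by
              gcongr
              · exact norm_le_pi_norm (D (T p)) j
              · exact norm_le_pi_norm (D (T e)) j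
    rw [map_sub, map_smul, smul_eq_mul] at h1
    have h2 : τ (T p) * L e ≤ |τ (T p)| * |L e| := by rw [← abs_mul]; exact le_abs_self _
    simp only [S, hC]
    nlinarith
  have hker : ∀ p, T p = 0 → L p = 0 := by
    intro p hp
    have h1 := hS p
    have h2 := hS (-p)
    simp only [map_neg, hp, S, map_zero, norm_zero, abs_zero, neg_zero] at h1 h2
    linarith
  obtain ⟨g, hg⟩ := T.rangeRestrict.exists_rightInverse_of_surjective T.range_rangeRestrict
  have hLg : ∀ p, L (g (T.rangeRestrict p)) = L p := by
    intro p
    have e2 := congrArg Subtype.val (LinearMap.congr_fun hg (T.rangeRestrict p))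
    have : L (g (T.rangeRestrict p) - p) = 0 := hker _ (by
      rw [map_sub, sub_eq_zero]; exact e2)
    rwa [map_sub, sub_eq_zero] at this
  obtain ⟨G, hG, hGS⟩ := exists_extension_of_le_sublinear ⟨LinearMap.range T, L.comp g⟩ S
    (fun c hc y => by
      simp only [S, map_smul, norm_smul, smul_eq_mul, abs_mul, Real.norm_eq_abs, abs_of_pos hc]
      ring)
    (fun y y' => by
      have h1 := norm_add_le (D y) (D y')
      have h2 := abs_add_le (τ y) (τ y')
      have hC0 : 0 ≤ C := by positivity
      simp only [S, map_add]
      nlinarith [mul_le_mul_of_nonneg_left h1 hρ0, mul_le_mul_of_nonneg_left h2 hC0])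
    (by
      rintro ⟨_, p, rfl⟩
      exact (hLg p).le.trans (hS p))
  have hGw : ∀ y, G y = ∑ j, G (Pi.single j 1) * y j := by
    intro y
    conv_lhs => rw [← Finset.univ_sum_single y]
    rw [map_sum]
    refine Finset.sum_congr rfl fun j _ => ?_
    rw [mul_comm, ← smul_eq_mul, ← map_smul]
    congr 1
    ext i
    simp [Pi.single_apply]
  refine ⟨fun j => G (Pi.single j 1), fun p => ?_, ?_⟩
  · rw [← hGw]
    exact (hG ⟨T p, p, rfl⟩).trans (hLg p)
  · set y : Fin N → ℝ := fun j => SignType.sign (G (Pi.single j 1)) * δ j with hy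
    have h1 : ∑ j, |G (Pi.single j 1)| * δ j = G y := by
      rw [hGw]
      refine Finset.sum_congr rfl fun j _ => ?_
      rw [hy, ← mul_assoc, self_mul_sign]
    have h2 : τ y = 0 := by
      rw [hτ]
      refine Finset.sum_eq_zero fun j _ => ?_
      split_ifs with h0
      · simp [hy, h0]
      · rfl
    have h3 : ‖D y‖ ≤ 1 := by
      rw [pi_norm_le_iff_of_nonneg zero_le_one]
      intro j
      rw [hD, hy, Real.norm_eq_abs]
      have hs : |(SignType.sign (G (Pi.single j 1)) : ℝ)| ≤ 1 := by
        cases SignType.sign (G (Pi.single j 1)) <;> simp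
      rcases (hδ j).eq_or_lt with h0 | hpos
      · simp [← h0]
      · rw [mul_comm, mul_assoc, mul_inv_cancel₀ hpos.ne', mul_one]; exact hs
    rw [h1]
    refine (hGS y).trans ?_
    simp only [S, h2, abs_zero, mul_zero, add_zero]
    exact mul_le_of_le_one_right hρ0 h3

end Duality

/-! ### The Hilbert space of annihilating functionals -/

section Functionals

variable {d : ℕ}

/-- The bilinear form `∑_{x,y} c_x c'_y K(x,y)`. -/
def kernelForm (K : Pt d → Pt d → ℝ) : (Pt d →₀ ℝ) →ₗ[ℝ] (Pt d →₀ ℝ) →ₗ[ℝ] ℝ :=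
  Finsupp.linearCombination ℝ fun x => Finsupp.linearCombination ℝ (K x)

theorem kernelForm_single_left (K : Pt d → Pt d → ℝ) (x : Pt d) (c : Pt d →₀ ℝ) :
    kernelForm K (Finsupp.single x 1) c = Finsupp.linearCombination ℝ (K x) c := by
  simp [kernelForm]

theorem kernelForm_single (K : Pt d → Pt d → ℝ) (x y : Pt d) :
    kernelForm K (Finsupp.single x 1) (Finsupp.single y 1) = K x y := by
  simp [kernelForm]

theorem kernelForm_apply (K : Pt d → Pt d → ℝ) (c c' : Pt d →₀ ℝ) :
    kernelForm K c c' = ∑ x ∈ c.support, ∑ y ∈ c'.support, c x * c' y * K x y := by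
  simp [kernelForm, Finsupp.linearCombination_apply, Finsupp.sum, LinearMap.sum_apply,
    Finset.mul_sum, mul_assoc]

theorem quadForm_eq (K : Pt d → Pt d → ℝ) (c : Pt d →₀ ℝ) : quadForm K c = kernelForm K c c := by
  rw [kernelForm_apply]; rfl

theorem sum_polyFun_eq (p : MvPolynomial (Fin d) ℝ) (c : Pt d →₀ ℝ) :
    (c.sum fun x cx => cx * polyFun p x) = Finsupp.linearCombination ℝ (polyFun p) c := rfl

/-- The space of functionals `∑ c_x δ_x` with `x ∈ Ω` annihilating the polynomials of degree less
than `s`. -/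
def annihilators (Ω : Set (Pt d)) (s : ℕ) : Submodule ℝ (Pt d →₀ ℝ) where
  carrier := {c | Annihilates Ω s c}
  zero_mem' := ⟨by simp, by simp⟩
  add_mem' := by
    classical
    intro c c' hc hc'
    refine ⟨fun x hx => ?_, fun p hp => ?_⟩
    · rcases Finset.mem_union.1 (Finsupp.support_add hx) with h | h
      exacts [hc.1 x h, hc'.1 x h]
    · have h1 := hc.2 p hp
      have h2 := hc'.2 p hp
      rw [sum_polyFun_eq] at h1 h2 ⊢
      rw [map_add, h1, h2, add_zero]
  smul_mem' := by
    intro a c hc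
    refine ⟨fun x hx => hc.1 x (Finsupp.support_smul hx), fun p hp => ?_⟩
    have h1 := hc.2 p hp
    rw [sum_polyFun_eq] at h1 ⊢
    rw [map_smul, h1, smul_zero]

theorem kernelForm_comm {K : Pt d → Pt d → ℝ} {Ω : Set (Pt d)}
    (hK : ∀ x ∈ Ω, ∀ y ∈ Ω, K x y = K y x) {c c' : Pt d →₀ ℝ} (hc : ∀ x ∈ c.support, x ∈ Ω)
    (hc' : ∀ x ∈ c'.support, x ∈ Ω) : kernelForm K c c' = kernelForm K c' c := by
  rw [kernelForm_apply, kernelForm_apply, Finset.sum_comm]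
  refine Finset.sum_congr rfl fun y hy => Finset.sum_congr rfl fun x hx => ?_
  rw [hK x (hc x hx) y (hc' y hy)]; ring

/-- The functionals annihilating the polynomials embed into a Hilbert space. -/
theorem exists_hilbert {K : Pt d → Pt d → ℝ} {Ω : Set (Pt d)} {s : ℕ} (hK : IsCPD K Ω s) :
    ∃ (H : Type) (_ : NormedAddCommGroup H) (_ : InnerProductSpace ℝ H) (_ : CompleteSpace H)
      (J : annihilators Ω s →ₗ[ℝ] H), ∀ c c' : annihilators Ω s,
        inner ℝ (J c) (J c') = kernelForm K c c' := by
  -- Strict conditional positivity makes the form definite, so no quotient by null vectors is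
  -- needed.
  let core : InnerProductSpace.Core ℝ (annihilators Ω s) :=
    { inner := fun c c' => kernelForm K c c'
      conj_inner_symm := fun c c' => by
        simpa using kernelForm_comm hK.1 c'.2.1 c.2.1
      re_inner_nonneg := fun c => by
        by_cases h : (c : Pt d →₀ ℝ) = 0
        · simp [h]
        · simpa [quadForm_eq] using (hK.2 c c.2 h).le
      add_left := fun c c' e => by simp
      smul_left := fun c c' a => by simp
      definite := fun c h => by
        by_contra hne
        have := hK.2 c c.2 (fun h => hne (Subtype.ext h))
        rw [quadForm_eq] at this
        exact this.ne' h }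
  let := core.toNormedAddCommGroup
  let _ : InnerProductSpace ℝ (annihilators Ω s) := InnerProductSpace.ofCore core.toCore
  refine ⟨UniformSpace.Completion (annihilators Ω s), inferInstance, inferInstance, inferInstance,
    (UniformSpace.Completion.toComplₗᵢ (𝕜 := ℝ) (E := annihilators Ω s)).toLinearMap,
    fun c c' => ?_⟩
  exact UniformSpace.Completion.inner_coe c c'

end Functionals

/-! ### The feature map and the representation of native functions -/

section FeatureMaps

variable {d : ℕ}

/-- A Hilbert space `H` of functionals annihilating the polynomials of degree less than `s`,
with the partial derivatives `Ψ α` of the map sending `y ∈ U` to the functional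
`δ_y - ∑_ξ ℓ_ξ(y) δ_ξ`. -/
structure FeatureMap (K : Pt d → Pt d → ℝ) (Ω U : Set (Pt d)) (s r : ℕ) (H : Type*)
    [NormedAddCommGroup H] [InnerProductSpace ℝ H] where
  J : annihilators Ω s →ₗ[ℝ] H
  inner_J : ∀ c c' : annihilators Ω s, inner ℝ (J c) (J c') = kernelForm K c c'
  nodes : Finset (Pt d)
  nodes_subset : ↑nodes ⊆ U
  cardinal : nodes → MvPolynomial (Fin d) ℝ
  cardinal_mem : ∀ ξ, cardinal ξ ∈ polySpace d s
  interpolation : ∀ p ∈ polySpace d s, ∀ y ∈ U,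
    polyFun p y = ∑ ξ : nodes, polyFun p ξ * polyFun (cardinal ξ) y
  Ψ : (Fin d → ℕ) → Pt d → H
  family : IsPartialFamily r U Ψ
  inner_Ψ : ∀ α β, ∑ i, α i ≤ r → ∑ i, β i ≤ r → ∀ x ∈ U, ∀ y ∈ U,
    inner ℝ (Ψ α x) (Ψ β y) = kernelPartial α β K x y
      - ∑ ξ : nodes, kernelPartial α 0 K x ξ * polyFun (polyPartial β (cardinal ξ)) y
      - ∑ ξ : nodes, polyFun (polyPartial α (cardinal ξ)) x * kernelPartial 0 β K ξ y
      + ∑ ξ : nodes, ∑ η : nodes, polyFun (polyPartial α (cardinal ξ)) x *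
          (K ξ η * polyFun (polyPartial β (cardinal η)) y)
  Ψ_zero : ∀ y ∈ U, ∃ h : Finsupp.single y 1 - ∑ ξ : nodes,
      polyFun (cardinal ξ) y • Finsupp.single (ξ : Pt d) 1 ∈ annihilators Ω s, Ψ 0 y = J ⟨_, h⟩

instance finiteDimensional_polySpace (s : ℕ) : FiniteDimensional ℝ (polySpace d s) := by
  have : Finite {m : Fin d →₀ ℕ | m.degree < s} := (Finsupp.finite_of_degree_lt s).to_subtype
  exact (MvPolynomial.basisRestrictSupport ℝ
    {m : Fin d →₀ ℕ | m.degree < s}).finiteDimensional_of_finite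

/-- The coefficients `ℓ_ξ(y)` are polynomials in `y`, so the Gram kernel of the corrected
evaluations has as many continuous derivatives as `K`. The Gram criterion transfers them to the map.
-/
theorem exists_featureMap {K : Pt d → Pt d → ℝ} {Ω U : Set (Pt d)} {s r : ℕ}
    (hK : IsCPD K Ω s) (hU : IsOpen U) (hUΩ : U ⊆ Ω) (hKr : HasContinuousPartials K r U) :
    ∃ (H : Type) (_ : NormedAddCommGroup H) (_ : InnerProductSpace ℝ H) (_ : CompleteSpace H),
      Nonempty (FeatureMap K Ω U s r H) := by
  classical
  obtain ⟨H, _, _, _, J, hJ⟩ := exists_hilbert hK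
  refine ⟨H, inferInstance, inferInstance, inferInstance, ?_⟩
  let ev : Pt d → polySpace d s →ₗ[ℝ] ℝ := fun y =>
    { toFun := fun p => polyFun (p : MvPolynomial (Fin d) ℝ) y
      map_add' := fun p p' => polyFun_add _ _ _
      map_smul' := fun c p => polyFun_smul _ _ _ }
  obtain ⟨X, hX, ℓ, hℓ⟩ := exists_interpolation ev U
  have hint : ∀ p ∈ polySpace d s, ∀ y ∈ U,
      polyFun p y = ∑ ξ : X, polyFun p ξ * polyFun (ℓ ξ : MvPolynomial (Fin d) ℝ) y :=
    fun p hp y hy => hℓ y hy ⟨p, hp⟩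
  have hmem : ∀ y ∈ U, Finsupp.single y 1 - ∑ ξ : X,
      polyFun (ℓ ξ : MvPolynomial (Fin d) ℝ) y • Finsupp.single (ξ : Pt d) 1 ∈
        annihilators Ω s := by
    intro y hy
    refine ⟨fun x hx => ?_, fun p hp => ?_⟩
    · by_contra hxΩ
      rw [Finsupp.mem_support_iff] at hx
      apply hx
      have h1 : y ≠ x := fun h => hxΩ (h ▸ hUΩ hy)
      have h2 : ∀ ξ : X, (ξ : Pt d) ≠ x := fun ξ h => hxΩ (h ▸ hUΩ (hX ξ.2))
      simp [Finsupp.sub_apply, Finsupp.finsetSum_apply, h1, h2]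
    · rw [sum_polyFun_eq, map_sub, map_sum]
      simp [Finsupp.linearCombination_single, hint p hp y hy, mul_comm]
  let Φ : Pt d → H := fun y => if h : y ∈ U then J ⟨_, hmem y h⟩ else 0
  have hΦ : ∀ y (h : y ∈ U), Φ y = J ⟨_, hmem y h⟩ := fun y h => dif_pos h
  have hQ := isDoubleFamily_kernelPartial hU hKr
  have hP : ∀ ξ : X, IsPartialFamily r U
      (fun α => polyFun (polyPartial α (ℓ ξ : MvPolynomial (Fin d) ℝ))) :=
    fun ξ => isPartialFamily_poly r U _
  have hG := ((hQ.sub (IsDoubleFamily.sum Finset.univ fun (ξ : X) _ =>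
      (hQ.fst (hX ξ.2)).mul (hP ξ))).sub (IsDoubleFamily.sum Finset.univ fun (ξ : X) _ =>
      (hP ξ).mul (hQ.snd (hX ξ.2)))).add (IsDoubleFamily.sum Finset.univ fun (ξ : X) _ =>
        IsDoubleFamily.sum Finset.univ fun (η : X) _ =>
          (hP ξ).mul ((hP η).const_smul (K ξ η)))
  obtain ⟨Ψ, hΨ0, hΨ, hΨG⟩ := exists_isPartialFamily_of_gram (Φ := Φ) hU hG (by
    intro x hx y hy
    rw [hΦ x hx, hΦ y hy, hJ]
    simp only [map_sub, map_sum, LinearMap.sub_apply, LinearMap.sum_apply, map_smul,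
      LinearMap.smul_apply, kernelForm_single, kernelPartial_zero, polyPartial_zero, smul_eq_mul,
      mul_sub, Finset.mul_sum, Finset.sum_sub_distrib]
    have e1 : ∀ ξ : X, polyFun (ℓ ξ : MvPolynomial (Fin d) ℝ) y * K x ξ =
      K x ξ * polyFun (ℓ ξ : MvPolynomial (Fin d) ℝ) y := fun ξ => mul_comm _ _
    have e2 : ∀ ξ η : X, polyFun (ℓ ξ : MvPolynomial (Fin d) ℝ) y *
        (polyFun (ℓ η : MvPolynomial (Fin d) ℝ) x * K η ξ) =
      polyFun (ℓ η : MvPolynomial (Fin d) ℝ) x *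
        (K η ξ * polyFun (ℓ ξ : MvPolynomial (Fin d) ℝ) y) := fun ξ η => by ring
    simp only [e1, e2]
    rw [Finset.sum_comm (s := Finset.univ) (t := Finset.univ) (f := fun ξ η : X =>
      polyFun (ℓ η : MvPolynomial (Fin d) ℝ) x *
        (K η ξ * polyFun (ℓ ξ : MvPolynomial (Fin d) ℝ) y))]
    ring)
  exact ⟨{
    J := J
    inner_J := hJ
    nodes := X
    nodes_subset := hX
    cardinal := fun ξ => ℓ ξ
    cardinal_mem := fun ξ => (ℓ ξ).2
    interpolation := hint
    Ψ := Ψ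
    family := hΨ
    inner_Ψ := hΨG
    Ψ_zero := fun y hy => ⟨hmem y hy, by rw [hΨ0, hΦ y hy]⟩ }⟩

namespace FeatureMap

variable {K : Pt d → Pt d → ℝ} {Ω U : Set (Pt d)} {s r : ℕ} {H : Type*}
  [NormedAddCommGroup H] [InnerProductSpace ℝ H] (A : FeatureMap K Ω U s r H)

theorem norm_J (c : annihilators Ω s) : ‖A.J c‖ = √(quadForm K c) := by
  rw [quadForm_eq, ← A.inner_J, real_inner_self_eq_norm_sq, Real.sqrt_sq (norm_nonneg _)]

theorem inner_Ψ_zero_J {y : Pt d} (hy : y ∈ U) (c : annihilators Ω s) :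
    inner ℝ (A.Ψ 0 y) (A.J c) = Finsupp.linearCombination ℝ (K y) (c : Pt d →₀ ℝ) -
      ∑ ξ : A.nodes, polyFun (A.cardinal ξ) y *
        Finsupp.linearCombination ℝ (K ξ) (c : Pt d →₀ ℝ) := by
  obtain ⟨h, e⟩ := A.Ψ_zero y hy
  rw [e, A.inner_J]
  simp only [map_sub, map_sum, map_smul, LinearMap.sub_apply, LinearMap.sum_apply,
    LinearMap.smul_apply, kernelForm_single_left, smul_eq_mul]

/-- Functions of the native space are represented by vectors of the Hilbert space. -/
theorem exists_representer [CompleteSpace H] (hUΩ : U ⊆ Ω) {f : Pt d → ℝ} {c : ℕ → Pt d →₀ ℝ}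
    {p : ℕ → MvPolynomial (Fin d) ℝ} (hf : IsNativeApprox K Ω s f c p) :
    ∃ g : H, Tendsto (fun n => A.J ⟨c n, hf.1 n⟩) atTop (𝓝 g) ∧
      ∀ y ∈ U, f y = inner ℝ (A.Ψ 0 y) g + ∑ ξ : A.nodes, f ξ * polyFun (A.cardinal ξ) y := by
  obtain ⟨hc, hp, hcau, hlim⟩ := hf
  have hC : CauchySeq fun n => A.J ⟨c n, hc n⟩ := by
    rw [Metric.cauchySeq_iff]
    intro ε hε
    obtain ⟨n₀, hn⟩ := hcau (ε ^ 2) (by positivity)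
    refine ⟨n₀, fun m hm n hn' => ?_⟩
    rw [dist_eq_norm, ← map_sub, A.norm_J, Real.sqrt_lt' hε]
    exact hn m hm n hn'
  obtain ⟨g, hg⟩ := cauchySeq_tendsto_of_complete hC
  refine ⟨g, hg, fun y hy => ?_⟩
  have h1 : Tendsto (fun n => inner ℝ (A.Ψ 0 y) (A.J ⟨c n, hc n⟩)) atTop
      (𝓝 (inner ℝ (A.Ψ 0 y) g)) := tendsto_const_nhds.inner hg
  -- The `p n` are reproduced by interpolation on `U`, so they cancel here. Their own convergence is
  -- not needed.
  have h2 : Tendsto (fun n => (((c n).sum fun x cx => cx * K y x) + polyFun (p n) y) -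
      ∑ ξ : A.nodes, (((c n).sum fun x cx => cx * K ξ x) + polyFun (p n) ξ) *
        polyFun (A.cardinal ξ) y) atTop
      (𝓝 (f y - ∑ ξ : A.nodes, f ξ * polyFun (A.cardinal ξ) y)) :=
    (hlim y (hUΩ hy)).sub (tendsto_finsetSum _ fun ξ _ =>
      (hlim ξ (hUΩ (A.nodes_subset ξ.2))).mul_const _)
  have h3 := tendsto_nhds_unique (h1.congr fun n => ?_) h2
  · linarith
  · rw [A.inner_Ψ_zero_J hy, A.interpolation (p n) (hp n) y hy]
    simp only [add_mul, Finset.sum_add_distrib]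
    have e1 : ∀ ξ : Pt d, ((c n).sum fun x cx => cx * K ξ x) =
      Finsupp.linearCombination ℝ (K ξ) (c n) := fun ξ => rfl
    simp only [e1, mul_comm]
    ring

end FeatureMap

end FeatureMaps

/-! ### Segments from `z`, Hölder seminorms and the kernel seminorm -/

section Stars

variable {d N : ℕ}

theorem starSet_eq (z : Pt d) (x : Fin N → Pt d) :
    starSet z x = ⋃ j, (fun t : ℝ => z + t • (x j - z)) '' Icc 0 1 := by
  simp only [starSet, segment_eq_image']

theorem isCompact_starSet (z : Pt d) (x : Fin N → Pt d) : IsCompact (starSet z x) := by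
  rw [starSet_eq]
  exact isCompact_iUnion fun j => isCompact_Icc.image (by fun_prop)

theorem mem_starSet (z : Pt d) (x : Fin N → Pt d) (j : Fin N) {t : ℝ} (ht : t ∈ Icc (0 : ℝ) 1) :
    z + t • (x j - z) ∈ starSet z x := by
  rw [starSet_eq]
  exact mem_iUnion.2 ⟨j, t, ht, rfl⟩

theorem node_mem_starSet (z : Pt d) (x : Fin N → Pt d) (j : Fin N) : x j ∈ starSet z x := by
  simpa using mem_starSet z x j (t := 1) (by simp)

theorem starSet_starShaped {z : Pt d} {x : Fin N → Pt d} {u : Pt d} (hu : u ∈ starSet z x) {t : ℝ}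
    (ht : t ∈ Icc (0 : ℝ) 1) : z + t • (u - z) ∈ starSet z x := by
  rw [starSet_eq] at hu
  obtain ⟨j, t', ht', rfl⟩ := mem_iUnion.1 hu
  have := mem_starSet z x j (t := t * t') ⟨mul_nonneg ht.1 ht'.1, mul_le_one₀ ht.2 ht'.1 ht'.2⟩
  simpa [smul_smul] using this

/-- The second difference at `z` occurring in the Hölder seminorm. -/
def secondDiff (V : Pt d → Pt d → ℝ) (z u v : Pt d) : ℝ := V u v - V u z - V z v + V z z

theorem holderSeminorm_ne_top {V : Pt d → Pt d → ℝ} {z : Pt d} {x : Fin N → Pt d} {C : ℝ}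
    (h : ∀ u ∈ starSet z x, ∀ v ∈ starSet z x,
      |secondDiff V z u v| ≤ C * (‖u - z‖ * ‖v - z‖)) : holderSeminorm V z x 1 ≠ ∞ := by
  refine ne_top_of_le_ne_top (b := ENNReal.ofReal C) ENNReal.ofReal_ne_top ?_
  refine iSup₂_le fun u hu => iSup₂_le fun v hv => ENNReal.ofReal_le_ofReal ?_
  have h1 : 0 < ‖u - z‖ := norm_pos_iff.2 (sub_ne_zero.2 hu.2)
  have h2 : 0 < ‖v - z‖ := norm_pos_iff.2 (sub_ne_zero.2 hv.2)
  rw [Real.rpow_one, Real.rpow_one, div_le_iff₀ (by positivity)]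
  exact h u hu.1 v hv.1

theorem abs_secondDiff_le {V : Pt d → Pt d → ℝ} {z : Pt d} {x : Fin N → Pt d}
    (h : holderSeminorm V z x 1 ≠ ∞) {u v : Pt d} (hu : u ∈ starSet z x) (hv : v ∈ starSet z x) :
    |secondDiff V z u v| ≤ (holderSeminorm V z x 1).toReal * (‖u - z‖ * ‖v - z‖) := by
  by_cases hu0 : u = z
  · subst hu0; simp [secondDiff]
  by_cases hv0 : v = z
  · subst hv0; simp [secondDiff]
  have h1 : 0 < ‖u - z‖ := norm_pos_iff.2 (sub_ne_zero.2 hu0)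
  have h2 : 0 < ‖v - z‖ := norm_pos_iff.2 (sub_ne_zero.2 hv0)
  rw [← div_le_iff₀ (by positivity), ← ENNReal.ofReal_le_iff_le_toReal h]
  refine le_trans ?_ (le_iSup₂_of_le (f := fun u _ => ⨆ v ∈ starSet z x \ {z},
    ENNReal.ofReal (|V u v - V u z - V z v + V z z| / (‖u - z‖ ^ (1 : ℝ) * ‖v - z‖ ^ (1 : ℝ))))
    u ⟨hu, hu0⟩ (le_iSup₂ (f := fun v _ =>
    ENNReal.ofReal (|V u v - V u z - V z v + V z z| / (‖u - z‖ ^ (1 : ℝ) * ‖v - z‖ ^ (1 : ℝ))))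
    v ⟨hv, hv0⟩))
  rw [Real.rpow_one, Real.rpow_one]; rfl

/-- The sum defining the kernel seminorm, for real values of the Hölder seminorms. -/
def holderSum (K : Pt d → Pt d → ℝ) (z : Pt d) (x : Fin N → Pt d) (m : ℕ) : ℝ :=
  ∑ α ∈ Finset.piAntidiag (Finset.univ : Finset (Fin d)) m,
    ∑ β ∈ Finset.piAntidiag (Finset.univ : Finset (Fin d)) m,
      (Nat.multinomial Finset.univ α : ℝ) * (Nat.multinomial Finset.univ β : ℝ) *
        (holderSeminorm (kernelPartial α β K) z x 1).toReal ^ 2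

theorem holderSum_nonneg (K : Pt d → Pt d → ℝ) (z : Pt d) (x : Fin N → Pt d) (m : ℕ) :
    0 ≤ holderSum K z x m := by unfold holderSum; positivity

theorem kernelSeminorm_ne_top {K : Pt d → Pt d → ℝ} {z : Pt d} {x : Fin N → Pt d} {m : ℕ}
    (h : ∀ α β : Fin d → ℕ, ∑ i, α i = m → ∑ i, β i = m →
      holderSeminorm (kernelPartial α β K) z x 1 ≠ ∞) : kernelSeminorm K z x m 1 ≠ ∞ := by
  refine ENNReal.mul_ne_top ENNReal.ofReal_ne_top (ENNReal.rpow_ne_top_of_nonneg (by norm_num) ?_)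
  refine ENNReal.sum_ne_top.2 fun α hα => ENNReal.sum_ne_top.2 fun β hβ => ?_
  rw [Finset.mem_piAntidiag] at hα hβ
  exact ENNReal.mul_ne_top (ENNReal.mul_ne_top (ENNReal.natCast_ne_top _)
    (ENNReal.natCast_ne_top _)) (ENNReal.pow_ne_top (h α β hα.1 hβ.1))

theorem prod_one_add_sq (m : ℕ) :
    ∏ i ∈ Finset.Icc 1 m, ((1 : ℝ) + (i : ℝ)) ^ 2 = ((m + 1).factorial : ℝ) ^ 2 := by
  induction m with
  | zero => simp
  | succ m ih =>
    rw [Finset.prod_Icc_succ_top (by omega), ih, Nat.factorial_succ (m + 1)]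
    push_cast; ring

theorem sqrt_toReal_kernelSeminorm {K : Pt d → Pt d → ℝ} {z : Pt d} {x : Fin N → Pt d} {m : ℕ}
    (h : ∀ α β : Fin d → ℕ, ∑ i, α i = m → ∑ i, β i = m →
      holderSeminorm (kernelPartial α β K) z x 1 ≠ ∞) :
    √(kernelSeminorm K z x m 1).toReal = √√(holderSum K z x m) / (m + 1).factorial := by
  have h1 : (kernelSeminorm K z x m 1).toReal =
      √(holderSum K z x m) / ((m + 1).factorial : ℝ) ^ 2 := by
    have hfin : ∀ α ∈ Finset.piAntidiag (Finset.univ : Finset (Fin d)) m,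
        ∀ β ∈ Finset.piAntidiag (Finset.univ : Finset (Fin d)) m,
        (Nat.multinomial Finset.univ α : ℝ≥0∞) * (Nat.multinomial Finset.univ β : ℝ≥0∞) *
          holderSeminorm (kernelPartial α β K) z x 1 ^ 2 ≠ ∞ := by
      intro α hα β hβ
      rw [Finset.mem_piAntidiag] at hα hβ
      exact ENNReal.mul_ne_top (ENNReal.mul_ne_top (ENNReal.natCast_ne_top _)
        (ENNReal.natCast_ne_top _)) (ENNReal.pow_ne_top (h α β hα.1 hβ.1))
    rw [kernelSeminorm, ENNReal.toReal_mul, prod_one_add_sq, ENNReal.toReal_ofReal (by positivity),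
      ← ENNReal.toReal_rpow, ENNReal.toReal_sum fun α hα =>
        ENNReal.sum_ne_top.2 fun β hβ => hfin α hα β hβ]
    have h2 : ∑ α ∈ Finset.piAntidiag (Finset.univ : Finset (Fin d)) m,
        (∑ β ∈ Finset.piAntidiag (Finset.univ : Finset (Fin d)) m,
        (Nat.multinomial Finset.univ α : ℝ≥0∞) * (Nat.multinomial Finset.univ β : ℝ≥0∞) *
          holderSeminorm (kernelPartial α β K) z x 1 ^ 2).toReal = holderSum K z x m := by
      refine Finset.sum_congr rfl fun α hα => ?_
      rw [ENNReal.toReal_sum fun β hβ => hfin α hα β hβ]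
      simp [ENNReal.toReal_mul, ENNReal.toReal_pow]
    rw [h2, Real.sqrt_eq_rpow]; ring
  rw [h1, Real.sqrt_div' _ (by positivity), Real.sqrt_sq (by positivity)]

/-- The multinomial theorem for `(∑ h_i²)^m`. It is the reason for the multinomial weights in the
kernel seminorm. -/
theorem sum_multinomial_sq (h : Pt d) (m : ℕ) :
    ∑ α ∈ Finset.piAntidiag (Finset.univ : Finset (Fin d)) m,
      (Nat.multinomial Finset.univ α : ℝ) * (∏ i, h i ^ α i) ^ 2 = (‖h‖ ^ m) ^ 2 := by
  rw [← pow_mul, mul_comm m 2, pow_mul, EuclideanSpace.norm_sq_eq,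
    Finset.sum_pow_eq_sum_piAntidiag]
  refine Finset.sum_congr rfl fun α _ => ?_
  rw [← Finset.prod_pow]
  congr 1
  refine Finset.prod_congr rfl fun i _ => ?_
  rw [Real.norm_eq_abs, sq_abs, ← pow_mul, ← pow_mul, mul_comm]

end Stars

/-! ### Taylor remainders of represented functions -/

namespace FeatureMap

variable {d N : ℕ} {K : Pt d → Pt d → ℝ} {Ω U : Set (Pt d)} {s r : ℕ} {H : Type*}
  [NormedAddCommGroup H] [InnerProductSpace ℝ H] (A : FeatureMap K Ω U s r H)

/-- Every correction term in `inner_Ψ` depends on one of the two variables only through a derivative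
of order `m` of a polynomial of degree less than `s ≤ m + 1`. That derivative is constant, so the
second difference removes the term. -/
theorem inner_sub_sub_eq_secondDiff {m : ℕ} (hs : s ≤ m + 1) (hm : m ≤ r) {α β : Fin d → ℕ}
    (hα : ∑ i, α i = m) (hβ : ∑ i, β i = m) {z u v : Pt d} (hz : z ∈ U) (hu : u ∈ U)
    (hv : v ∈ U) : inner ℝ (A.Ψ α u - A.Ψ α z) (A.Ψ β v - A.Ψ β z) =
      secondDiff (kernelPartial α β K) z u v := by
  have hαr : ∑ i, α i ≤ r := hα.le.trans hm
  have hβr : ∑ i, β i ≤ r := hβ.le.trans hm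
  rw [inner_sub_left, inner_sub_right, inner_sub_right, A.inner_Ψ α β hαr hβr u hu v hv,
    A.inner_Ψ α β hαr hβr u hu z hz, A.inner_Ψ α β hαr hβr z hz v hv,
    A.inner_Ψ α β hαr hβr z hz z hz]
  have eu : ∀ ξ, polyFun (polyPartial α (A.cardinal ξ)) u =
    polyFun (polyPartial α (A.cardinal ξ)) z := fun ξ =>
      polyPartial_const (A.cardinal_mem ξ) hs hα _ _
  have ev : ∀ ξ, polyFun (polyPartial β (A.cardinal ξ)) v =
    polyFun (polyPartial β (A.cardinal ξ)) z := fun ξ =>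
      polyPartial_const (A.cardinal_mem ξ) hs hβ _ _
  simp only [eu, ev, secondDiff]
  ring

/-- The derivatives of one order higher are continuous, hence bounded on the compact star, which
contains the segment from `z` to each of its points. -/
theorem exists_lipschitz_on_star (hU : IsOpen U) {z : Pt d} {x : Fin N → Pt d}
    (hS : starSet z x ⊆ U) {α : Fin d → ℕ} (hα : ∑ i, α i < r) :
    ∃ C, 0 ≤ C ∧ ∀ u ∈ starSet z x, ‖A.Ψ α u - A.Ψ α z‖ ≤ C * ‖u - z‖ := by
  have hcont : ContinuousOn (fun u => ∑ i, ‖A.Ψ (α + Pi.single i 1) u‖) (starSet z x) :=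
    continuousOn_finsetSum _ fun i _ =>
      ((A.family.2 _ (by rw [sum_add_single]; omega)).mono hS).norm
  obtain ⟨C, hC⟩ := (isCompact_starSet z x).exists_bound_of_continuousOn hcont
  refine ⟨max C 0, le_max_right _ _, fun u hu => ?_⟩
  have := norm_sub_le_of_norm_partials_le hU A.family hα (z := z) (h := u - z) (C := max C 0)
    (fun t ht => hS (starSet_starShaped hu ht)) (fun t ht =>
      ((le_abs_self _).trans (hC _ (starSet_starShaped hu ht))).trans (le_max_left _ _))
  simpa using this

/-- Cauchy–Schwarz for the second difference written as an inner product of two Lipschitz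
increments. -/
theorem holderSeminorm_kernelPartial_ne_top (A : FeatureMap K Ω U s r H) (hU : IsOpen U) {z : Pt d} {x : Fin N → Pt d}
    (hz : z ∈ U) (hS : starSet z x ⊆ U) {m : ℕ} (hs : s ≤ m + 1) (hm : m < r)
    (α β : Fin d → ℕ) (hα : ∑ i, α i = m) (hβ : ∑ i, β i = m) :
    holderSeminorm (kernelPartial α β K) z x 1 ≠ ∞ := by
  obtain ⟨C, hC0, hC⟩ := A.exists_lipschitz_on_star hU hS (α := α) (by omega)
  obtain ⟨C', hC0', hC'⟩ := A.exists_lipschitz_on_star hU hS (α := β) (by omega)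
  refine holderSeminorm_ne_top (C := C * C') fun u hu v hv => ?_
  rw [← A.inner_sub_sub_eq_secondDiff hs hm.le hα hβ hz (hS hu) (hS hv)]
  calc _ ≤ ‖A.Ψ α u - A.Ψ α z‖ * ‖A.Ψ β v - A.Ψ β z‖ := abs_real_inner_le_norm _ _
    _ ≤ (C * ‖u - z‖) * (C' * ‖v - z‖) :=
        mul_le_mul (hC u hu) (hC' v hv) (norm_nonneg _) (by positivity)
    _ = _ := by ring

/-- The `m`-th directional derivatives of the feature map are Lipschitz along the star. -/
theorem norm_sum_dirCoeff_le (hU : IsOpen U) {z : Pt d} {x : Fin N → Pt d}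
    (hz : z ∈ U) (hS : starSet z x ⊆ U) {m : ℕ} (hs : s ≤ m + 1) (hm : m < r) (h : Pt d)
    {u : Pt d} (hu : u ∈ starSet z x) :
    ‖∑ α ∈ Finset.piAntidiag (Finset.univ : Finset (Fin d)) m,
      dirCoeff h α • (A.Ψ α u - A.Ψ α z)‖ ≤
        √√(holderSum K z x m) * (‖h‖ ^ m * ‖u - z‖) := by
  set I := Finset.piAntidiag (Finset.univ : Finset (Fin d)) m with hI
  have hI' : ∀ α ∈ I, ∑ i, α i = m := fun α hα => ((Finset.mem_piAntidiag).1 hα).1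
  set c : (Fin d → ℕ) → (Fin d → ℕ) → ℝ := fun α β =>
    (holderSeminorm (kernelPartial α β K) z x 1).toReal with hc
  have hc0 : ∀ α β, 0 ≤ c α β := fun α β => ENNReal.toReal_nonneg
  have h1 : ‖∑ α ∈ I, dirCoeff h α • (A.Ψ α u - A.Ψ α z)‖ ^ 2 ≤
      (∑ q ∈ I ×ˢ I, |dirCoeff h q.1| * |dirCoeff h q.2| * c q.1 q.2) * ‖u - z‖ ^ 2 := by
    rw [← real_inner_self_eq_norm_sq, sum_inner, Finset.sum_product, Finset.sum_mul]
    refine Finset.sum_le_sum fun α hα => ?_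
    rw [inner_sum, Finset.sum_mul]
    refine Finset.sum_le_sum fun β hβ => ?_
    rw [real_inner_smul_left, real_inner_smul_right,
      A.inner_sub_sub_eq_secondDiff hs hm.le (hI' α hα) (hI' β hβ) hz (hS hu) (hS hu)]
    have h2 := abs_secondDiff_le (A.holderSeminorm_kernelPartial_ne_top hU hz hS hs hm α β
      (hI' α hα) (hI' β hβ)) hu hu
    calc _ ≤ |dirCoeff h α * (dirCoeff h β * secondDiff (kernelPartial α β K) z u u)| :=
          le_abs_self _
      _ = |dirCoeff h α| * |dirCoeff h β| * |secondDiff (kernelPartial α β K) z u u| := by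
          rw [abs_mul, abs_mul, mul_assoc]
      _ ≤ |dirCoeff h α| * |dirCoeff h β| * (c α β * (‖u - z‖ * ‖u - z‖)) := by gcongr
      _ = _ := by ring
  -- Cauchy–Schwarz over pairs of multi-indices, with each multinomial coefficient split evenly
  -- between the powers of `h` and the seminorms.
  have h3 : (∑ q ∈ I ×ˢ I, |dirCoeff h q.1| * |dirCoeff h q.2| * c q.1 q.2) ^ 2 ≤
      ((‖h‖ ^ m) ^ 2) ^ 2 * holderSum K z x m := by
    have h4 := Finset.sum_sq_le_sum_mul_sum_of_sq_le_mul (I ×ˢ I)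
      (r := fun q => |dirCoeff h q.1| * |dirCoeff h q.2| * c q.1 q.2)
      (f := fun q => ((Nat.multinomial Finset.univ q.1 : ℝ) * (∏ i, h i ^ q.1 i) ^ 2) *
        ((Nat.multinomial Finset.univ q.2 : ℝ) * (∏ i, h i ^ q.2 i) ^ 2))
      (g := fun q => (Nat.multinomial Finset.univ q.1 : ℝ) * (Nat.multinomial Finset.univ q.2 : ℝ) *
        c q.1 q.2 ^ 2)
      (fun q _ => by positivity) (fun q _ => by positivity) (fun q _ => le_of_eq (by
        simp only [mul_pow, sq_abs, dirCoeff]; ring))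
    refine h4.trans (le_of_eq ?_)
    congr 1
    · rw [Finset.sum_product]
      simp only
      rw [← Finset.sum_mul_sum, sum_multinomial_sq, sq ((‖h‖ ^ m) ^ 2)]
    · rw [Finset.sum_product]; rfl
  have h5 : ∑ q ∈ I ×ˢ I, |dirCoeff h q.1| * |dirCoeff h q.2| * c q.1 q.2 ≤
      (‖h‖ ^ m) ^ 2 * √(holderSum K z x m) := by
    refine (abs_le_of_sq_le_sq' ?_ (by positivity)).2
    rw [mul_pow, Real.sq_sqrt (holderSum_nonneg K z x m)]
    exact h3
  refine (abs_le_of_sq_le_sq' (h1.trans ?_) (by positivity)).2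
  rw [mul_pow, mul_pow, Real.sq_sqrt (Real.sqrt_nonneg _), ← mul_assoc,
    mul_comm (√(holderSum K z x m))]
  gcongr

/-- Taylor's formula for the functions represented by the Hilbert space. -/
theorem exists_taylor_error_le (hU : IsOpen U) {z : Pt d} {x : Fin N → Pt d}
    (hz : z ∈ U) (hS : starSet z x ⊆ U) {m : ℕ} (hs : s ≤ m + 1) (hm : m < r) (e : H) :
    ∃ T ∈ polySpace d (m + 1),
      (∀ α : Fin d → ℕ, ∑ i, α i ≤ m → polyFun (polyPartial α T) z = inner ℝ (A.Ψ α z) e) ∧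
      ∀ j, |inner ℝ (A.Ψ 0 (x j)) e - polyFun T (x j)| ≤
        ‖x j - z‖ ^ (m + 1) * √(kernelSeminorm K z x m 1).toReal * ‖e‖ := by
  obtain ⟨T, hT, hTz⟩ := exists_taylor_polynomial (m + 1) z fun α => inner ℝ (A.Ψ α z) e
  have hTz' : ∀ α : Fin d → ℕ, ∑ i, α i ≤ m →
    polyFun (polyPartial α T) z = inner ℝ (A.Ψ α z) e := fun α hα => hTz α (by omega)
  refine ⟨T, hT, hTz', fun j => ?_⟩
  have hψ : IsPartialFamily m U
      (fun α y => inner ℝ (A.Ψ α y) e - polyFun (polyPartial α T) y) :=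
    ((A.family.mono hm.le).inner_const e).sub (isPartialFamily_poly m U T)
  have key := norm_le_of_norm_dirDeriv_le hU hψ (z := z) (h := x j - z)
    (C := √√(holderSum K z x m) * ‖x j - z‖ ^ (m + 1) * ‖e‖)
    (fun t ht => hS (mem_starSet z x j ht)) (fun α hα => by rw [hTz' α hα, sub_self])
    (fun t ht => by
      -- Derivatives of order `m` of `T` keep their value at `z`, which is `⟨Ψ α z, e⟩`. The
      -- remainder thus involves only increments of `Ψ α`.
      have e1 : dirDeriv (fun α y => inner ℝ (A.Ψ α y) e - polyFun (polyPartial α T) y) z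
          (x j - z) m t = inner ℝ (∑ α ∈ Finset.piAntidiag (Finset.univ : Finset (Fin d)) m,
            dirCoeff (x j - z) α • (A.Ψ α (z + t • (x j - z)) - A.Ψ α z)) e := by
        rw [sum_inner]
        refine Finset.sum_congr rfl fun α hα => ?_
        have hα := ((Finset.mem_piAntidiag).1 hα).1
        simp only [real_inner_smul_left, inner_sub_left, polyPartial_const hT le_rfl hα _ z,
          hTz' α hα.le, smul_eq_mul]
      rw [e1]
      refine (norm_inner_le_norm _ _).trans ?_
      have h2 := A.norm_sum_dirCoeff_le hU hz hS hs hm (x j - z) (mem_starSet z x j ht)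
      rw [add_sub_cancel_left, norm_smul, Real.norm_eq_abs, abs_of_nonneg ht.1] at h2
      calc _ ≤ √√(holderSum K z x m) * (‖x j - z‖ ^ m * (t * ‖x j - z‖)) * ‖e‖ := by gcongr
        _ = _ := by ring)
  rw [sqrt_toReal_kernelSeminorm (A.holderSeminorm_kernelPartial_ne_top hU hz hS hs hm)]
  simp only [polyPartial_zero, add_sub_cancel, Real.norm_eq_abs] at key
  refine key.trans (le_of_eq ?_)
  ring

end FeatureMap

/-! ### Polynomial exactness, well-posedness and competing weights -/

section Exactness

variable {d N : ℕ}

theorem diffOp_polyFun (k : ℕ) (a : (Fin d → ℕ) → Pt d → ℝ) (z : Pt d)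
    (p : MvPolynomial (Fin d) ℝ) :
    diffOp k a (polyFun p) z = familyOp k a z (fun α => polyFun (polyPartial α p)) :=
  (isPartialFamily_poly k univ p).diffOp_eq isOpen_univ (fun y _ => by rw [polyPartial_zero]) le_rfl
    (mem_univ z) a

/-- The functional `p ↦ D p(z)` on polynomials. -/
def polyOp (k : ℕ) (a : (Fin d → ℕ) → Pt d → ℝ) (z : Pt d) : MvPolynomial (Fin d) ℝ →ₗ[ℝ] ℝ where
  toFun p := diffOp k a (polyFun p) z
  map_add' p p' := by
    simp only [diffOp_polyFun, polyPartial_add, ← familyOp_add]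
    exact familyOp_congr fun α _ => polyFun_add _ _ _
  map_smul' c p := by
    simp only [diffOp_polyFun, polyPartial_smul, ← familyOp_smul, RingHom.id_apply]
    exact familyOp_congr fun α _ => polyFun_smul _ _ _

/-- The functional `p ↦ p(y)` on polynomials. -/
def polyEval (y : Pt d) : MvPolynomial (Fin d) ℝ →ₗ[ℝ] ℝ where
  toFun p := polyFun p y
  map_add' _ _ := polyFun_add _ _ _
  map_smul' _ _ := polyFun_smul _ _ _

/-- The weights `w` are exact for the polynomials of degree less than `s`. -/
def IsExactBelow (k : ℕ) (a : (Fin d → ℕ) → Pt d → ℝ) (z : Pt d) (x : Fin N → Pt d) (s : ℕ)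
    (w : Fin N → ℝ) : Prop :=
  ∀ p ∈ polySpace d s, ∑ j, w j * polyFun p (x j) = diffOp k a (polyFun p) z

theorem IsExactOn.isExactBelow {M s k : ℕ} {a : (Fin d → ℕ) → Pt d → ℝ} {z : Pt d}
    {x : Fin N → Pt d} {p : Module.Basis (Fin M) ℝ (polySpace d s)} {w : Fin N → ℝ}
    (h : IsExactOn k a z x (fun i => (p i : MvPolynomial (Fin d) ℝ)) w) :
    IsExactBelow k a z x s w := by
  have h1 : ((∑ j, w j • polyEval (x j)).comp (polySpace d s).subtype) =
      (polyOp k a z).comp (polySpace d s).subtype := by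
    refine p.ext fun i => ?_
    simpa [LinearMap.sum_apply, polyEval, polyOp] using h i
  intro p' hp'
  simpa [LinearMap.sum_apply, polyEval, polyOp] using LinearMap.congr_fun h1 ⟨p', hp'⟩

theorem sum_polyFun_eq_zero_of_basis {M s : ℕ} {x : Fin N → Pt d}
    (p : Module.Basis (Fin M) ℝ (polySpace d s)) {u : Fin N → ℝ}
    (h : ∀ l, ∑ j, u j * polyFun (p l : MvPolynomial (Fin d) ℝ) (x j) = 0)
    {p' : MvPolynomial (Fin d) ℝ} (hp' : p' ∈ polySpace d s) :
    ∑ j, u j * polyFun p' (x j) = 0 := by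
  have h1 : ((∑ j, u j • polyEval (x j)).comp (polySpace d s).subtype) = 0 := by
    refine p.ext fun i => ?_
    simpa [LinearMap.sum_apply, polyEval] using h i
  simpa [LinearMap.sum_apply, polyEval] using LinearMap.congr_fun h1 ⟨p', hp'⟩

/-- The functional `∑ u_j δ_{x_j}`. -/
def pointFunctional (x : Fin N → Pt d) (u : Fin N → ℝ) : Pt d →₀ ℝ :=
  ∑ j, u j • Finsupp.single (x j) 1

theorem linearCombination_pointFunctional (f : Pt d → ℝ) (x : Fin N → Pt d) (u : Fin N → ℝ) :
    Finsupp.linearCombination ℝ f (pointFunctional x u) = ∑ j, u j * f (x j) := by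
  simp [pointFunctional]

theorem pointFunctional_mem {Ω : Set (Pt d)} {s : ℕ} {x : Fin N → Pt d} {u : Fin N → ℝ}
    (hx : ∀ j, x j ∈ Ω) (hu : ∀ p ∈ polySpace d s, ∑ j, u j * polyFun p (x j) = 0) :
    pointFunctional x u ∈ annihilators Ω s := by
  refine ⟨fun y hy => ?_, fun p hp => ?_⟩
  · by_contra hyΩ
    rw [Finsupp.mem_support_iff] at hy
    apply hy
    have h2 : ∀ j, x j ≠ y := fun j h => hyΩ (h ▸ hx j)
    simp [pointFunctional, Finsupp.finsetSum_apply, h2]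
  · rw [sum_polyFun_eq, linearCombination_pointFunctional, hu p hp]

theorem kernelForm_pointFunctional (K : Pt d → Pt d → ℝ) (x : Fin N → Pt d) (u : Fin N → ℝ) :
    kernelForm K (pointFunctional x u) (pointFunctional x u) =
      ∑ i, ∑ j, u i * u j * K (x i) (x j) := by
  conv_lhs => enter [1]; rw [pointFunctional]
  simp only [map_sum, map_smul, LinearMap.sum_apply, LinearMap.smul_apply, kernelForm_single_left,
    linearCombination_pointFunctional, smul_eq_mul, Finset.mul_sum, mul_assoc]

theorem pointFunctional_ne_zero {x : Fin N → Pt d} (hx : Function.Injective x) {u : Fin N → ℝ}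
    (hu : u ≠ 0) : pointFunctional x u ≠ 0 := by
  classical
  intro h
  apply hu
  ext j
  have := DFunLike.congr_fun h (x j)
  simpa [pointFunctional, Finsupp.finsetSum_apply, Finsupp.single_apply, hx.eq_iff] using this

/-- The kernel-based formula is well defined. -/
theorem existsUnique_kernelWeight {K : Pt d → Pt d → ℝ} {Ω : Set (Pt d)} {s k M : ℕ}
    (hK : IsCPD K Ω s) (a : (Fin d → ℕ) → Pt d → ℝ) (z : Pt d) {x : Fin N → Pt d}
    (hx : Function.Injective x) (hxΩ : ∀ j, x j ∈ Ω)
    (p : Module.Basis (Fin M) ℝ (polySpace d s))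
    (hcons : ∃ w : Fin N → ℝ,
      IsExactOn k a z x (fun i => (p i : MvPolynomial (Fin d) ℝ)) w) :
    ∃! w : Fin N → ℝ, IsKernelWeight K k a z x (fun i => (p i : MvPolynomial (Fin d) ℝ)) w :=
  existsUnique_saddle (fun i j => K (x i) (x j))
    (fun i l => polyFun (p l : MvPolynomial (Fin d) ℝ) (x i))
    (fun u hu hu0 => by
      have h1 := hK.2 _ (pointFunctional_mem hxΩ fun p' hp' =>
        sum_polyFun_eq_zero_of_basis p hu hp') (pointFunctional_ne_zero hx hu0)
      rwa [quadForm_eq, kernelForm_pointFunctional] at h1)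
    (fun i => diffOp k a (fun y => K y (x i)) z)
    (fun l => diffOp k a (polyFun (p l : MvPolynomial (Fin d) ℝ)) z) hcons

/-- If the growth function is finite, it bounds the weighted `ℓ₁`-norm of some weights that are
exact for polynomials of degree less than `q`. -/
theorem exists_weights_of_growthFunction {k q : ℕ} (hq : 0 < q) (a : (Fin d → ℕ) → Pt d → ℝ)
    (z : Pt d) {x : Fin N → Pt d} (hx : Function.Injective x)
    (hρ : growthFunction k a q z x (q : ℝ) ≠ ∞) :
    ∃ w : Fin N → ℝ, IsExactBelow k a z x q w ∧
      ∑ j, |w j| * ‖x j - z‖ ^ q ≤ (growthFunction k a q z x (q : ℝ)).toReal := by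
  -- As `q > 0`, a weight vanishes only at a node equal to `z`. There is at most one such node, by
  -- injectivity.
  have h0 : ∀ i, ‖x i - z‖ ^ q = 0 → x i = z := fun i hi =>
    sub_eq_zero.1 (norm_eq_zero.1 (pow_eq_zero_iff hq.ne' |>.1 hi))
  obtain ⟨w, hw, hwρ⟩ := exists_weights
    (T := LinearMap.pi fun j => (polyEval (x j)).comp (polySpace d q).subtype)
    (L := (polyOp k a z).comp (polySpace d q).subtype)
    (δ := fun j => ‖x j - z‖ ^ q) (fun j => by positivity)
    (fun i j hi hj => hx ((h0 i hi).trans (h0 j hj).symm))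
    (e := ⟨1, one_mem_polySpace hq⟩) (fun j => by simp [polyEval, polyFun])
    (ρ := (growthFunction k a q z x (q : ℝ)).toReal) (fun p hp => by
      rw [← ENNReal.ofReal_le_iff_le_toReal hρ]
      refine le_iSup₂ (f := fun (p : MvPolynomial (Fin d) ℝ)
        (_ : p ∈ {p ∈ polySpace d q | ∀ j, |polyFun p (x j)| ≤ ‖x j - z‖ ^ (q : ℝ)}) =>
          ENNReal.ofReal (diffOp k a (polyFun p) z)) (p : MvPolynomial (Fin d) ℝ)
          ⟨p.2, fun j => ?_⟩
      rw [Real.rpow_natCast]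
      exact hp j)
  exact ⟨w, fun p hp => hw ⟨p, hp⟩, hwρ⟩

end Exactness

/-! ### The error vector: representation, optimality and bound -/

namespace FeatureMap

variable {d N : ℕ} {K : Pt d → Pt d → ℝ} {Ω U : Set (Pt d)} {s r : ℕ} {H : Type*}
  [NormedAddCommGroup H] [InnerProductSpace ℝ H] (A : FeatureMap K Ω U s r H)

/-- The vector representing the error functional `f ↦ D f(z) - ∑_j w_j f(x_j)`. -/
def errorVector (k : ℕ) (a : (Fin d → ℕ) → Pt d → ℝ) (z : Pt d) (x : Fin N → Pt d)
    (w : Fin N → ℝ) : H :=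
  familyOp k a z A.Ψ - ∑ j, w j • A.Ψ 0 (x j)

theorem inner_errorVector (k : ℕ) (a : (Fin d → ℕ) → Pt d → ℝ) (z : Pt d) (x : Fin N → Pt d)
    (w : Fin N → ℝ) (e : H) : inner ℝ (A.errorVector k a z x w) e =
      familyOp k a z (fun α y => inner ℝ (A.Ψ α y) e) - ∑ j, w j * inner ℝ (A.Ψ 0 (x j)) e := by
  rw [errorVector, inner_sub_left, ← familyOp_inner, sum_inner]
  simp only [real_inner_smul_left]

/-- The partial derivatives of the function with values `b ξ` at the nodes that is represented by
the vector `g`. -/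
def functionFamily (g : H) (b : A.nodes → ℝ) (α : Fin d → ℕ) (y : Pt d) : ℝ :=
  inner ℝ (A.Ψ α y) g + ∑ ξ, b ξ • polyFun (polyPartial α (A.cardinal ξ)) y

theorem isPartialFamily_functionFamily (g : H) (b : A.nodes → ℝ) :
    IsPartialFamily r U (A.functionFamily g b) :=
  (A.family.inner_const g).add (IsPartialFamily.sum _ fun ξ _ =>
    (isPartialFamily_poly r U (A.cardinal ξ)).const_smul (b ξ))

theorem eqOn_functionFamily {f : Pt d → ℝ} {g : H}
    (hf : ∀ y ∈ U, f y = inner ℝ (A.Ψ 0 y) g + ∑ ξ : A.nodes, f ξ * polyFun (A.cardinal ξ) y) :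
    EqOn f (A.functionFamily g (fun ξ => f ξ) 0) U := fun y hy => by
  simpa [functionFamily] using hf y hy

/-- The polynomial part `∑ f(ξ) ℓ_ξ` lies in `Π_s` and has zero error, so only the inner product
with `g` contributes. -/
theorem error_eq_inner (hU : IsOpen U) {k : ℕ} (hk : k ≤ r) (a : (Fin d → ℕ) → Pt d → ℝ)
    {z : Pt d} (hz : z ∈ U) {x : Fin N → Pt d} (hx : ∀ j, x j ∈ U) {w : Fin N → ℝ}
    (hw : IsExactBelow k a z x s w) {f : Pt d → ℝ} {g : H}
    (hf : ∀ y ∈ U, f y = inner ℝ (A.Ψ 0 y) g + ∑ ξ : A.nodes, f ξ * polyFun (A.cardinal ξ) y) :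
    diffOp k a f z - ∑ j, w j * f (x j) = inner ℝ (A.errorVector k a z x w) g := by
  rw [(A.isPartialFamily_functionFamily g _).diffOp_eq hU (A.eqOn_functionFamily hf) hk hz,
    inner_errorVector]
  have h1 : familyOp k a z (A.functionFamily g fun ξ => f ξ) =
      familyOp k a z (fun α y => inner ℝ (A.Ψ α y) g) +
        ∑ ξ : A.nodes, f ξ * ∑ j, w j * polyFun (A.cardinal ξ) (x j) := by
    unfold functionFamily
    rw [familyOp_add, familyOp_sum]
    congr 1
    refine Finset.sum_congr rfl fun ξ _ => ?_
    rw [familyOp_smul, hw _ (A.cardinal_mem ξ), diffOp_polyFun, smul_eq_mul]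
  have h2 : ∑ j, w j * f (x j) = ∑ j, w j * inner ℝ (A.Ψ 0 (x j)) g +
      ∑ ξ : A.nodes, f ξ * ∑ j, w j * polyFun (A.cardinal ξ) (x j) := by
    simp only [Finset.mul_sum]
    rw [Finset.sum_comm, ← Finset.sum_add_distrib]
    refine Finset.sum_congr rfl fun j _ => ?_
    rw [hf _ (hx j), mul_add, Finset.mul_sum]
    congr 1
    exact Finset.sum_congr rfl fun ξ _ => by ring
  rw [h1, h2]; ring

/-- The corrections sum to `∑_j u_j ℓ_ξ(x_j) = 0` at every interpolation node `ξ`. -/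
theorem sum_smul_Ψ_zero {x : Fin N → Pt d} (hx : ∀ j, x j ∈ U) {u : Fin N → ℝ}
    (hu : ∀ p ∈ polySpace d s, ∑ j, u j * polyFun p (x j) = 0)
    (hmem : pointFunctional x u ∈ annihilators Ω s) :
    ∑ j, u j • A.Ψ 0 (x j) = A.J ⟨pointFunctional x u, hmem⟩ := by
  choose h e using fun j => A.Ψ_zero (x j) (hx j)
  simp only [e, ← map_smul, ← map_sum]
  congr 1
  apply Subtype.ext
  simp only [AddSubmonoidClass.coe_finsetSum, Submodule.coe_smul, smul_sub,
    Finset.sum_sub_distrib, Finset.smul_sum, smul_smul]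
  rw [Finset.sum_comm]
  simp only [← Finset.sum_smul, hu _ (A.cardinal_mem _), zero_smul, Finset.sum_const_zero,
    sub_zero]
  rfl

/-- The error functional of the kernel-based formula is orthogonal to the functionals supported
on the nodes of the formula. -/
theorem inner_errorVector_eq_zero (hK : IsCPD K Ω s) (hU : IsOpen U) (hUΩ : U ⊆ Ω)
    (hKr : HasContinuousPartials K r U) {k M : ℕ} (hk : k ≤ r) (a : (Fin d → ℕ) → Pt d → ℝ)
    {z : Pt d} (hz : z ∈ U) {x : Fin N → Pt d} (hx : ∀ j, x j ∈ U)
    (p : Module.Basis (Fin M) ℝ (polySpace d s)) {w : Fin N → ℝ}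
    (hw : IsKernelWeight K k a z x (fun i => (p i : MvPolynomial (Fin d) ℝ)) w) {u : Fin N → ℝ}
    (hu : ∀ p ∈ polySpace d s, ∑ j, u j * polyFun p (x j) = 0) :
    inner ℝ (A.errorVector k a z x w) (∑ j, u j • A.Ψ 0 (x j)) = 0 := by
  obtain ⟨⟨v, hv⟩, hex⟩ := hw
  have hmem : pointFunctional x u ∈ annihilators Ω s :=
    pointFunctional_mem (fun j => hUΩ (hx j)) hu
  have hfam : ∀ j, IsPartialFamily r U (fun α y => kernelPartial α 0 K y (x j)) := fun j =>
    (isDoubleFamily_kernelPartial hU hKr).fst (hx j)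
  have hrep : ∀ y ∈ U, (∑ j, u j * K y (x j)) =
      inner ℝ (A.Ψ 0 y) (A.J ⟨pointFunctional x u, hmem⟩) +
        ∑ ξ : A.nodes, (∑ j, u j * K ξ (x j)) * polyFun (A.cardinal ξ) y := by
    intro y hy
    rw [A.inner_Ψ_zero_J hy]
    simp only [linearCombination_pointFunctional, mul_comm (∑ j, u j * K _ (x j))]
    ring
  rw [A.sum_smul_Ψ_zero hx hu hmem, ← A.error_eq_inner hU hk a hz hx hex.isExactBelow
    (f := fun y => ∑ j, u j * K y (x j)) hrep]
  rw [(IsPartialFamily.sum Finset.univ fun j _ => (hfam j).const_smul (u j)).diffOp_eq hU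
    (fun y _ => by simp [kernelPartial_zero]) hk hz, familyOp_sum]
  -- The kernel equation at `x j`, with `K` symmetric. The terms with `v` vanish after summation
  -- against `u`, leaving exactly the formula's value on `∑ u_j K(·, x_j)`.
  have h1 : ∀ j, familyOp k a z (fun α y => u j • kernelPartial α 0 K y (x j)) =
      u j * (∑ i, w i * K (x i) (x j) + ∑ l, v l * polyFun (p l : MvPolynomial (Fin d) ℝ) (x j)) := by
    intro j
    rw [familyOp_smul, smul_eq_mul, ← (hfam j).diffOp_eq (f := fun y => K y (x j)) hU
      (fun y _ => by simp [kernelPartial_zero]) hk hz, ← hv j]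
    congr 2
    exact Finset.sum_congr rfl fun i _ => by rw [hK.1 _ (hUΩ (hx j)) _ (hUΩ (hx i))]
  simp only [h1, mul_add, Finset.sum_add_distrib, Finset.mul_sum]
  have h2 : ∑ j, ∑ l, u j * (v l * polyFun (p l : MvPolynomial (Fin d) ℝ) (x j)) = 0 := by
    rw [Finset.sum_comm]
    refine Finset.sum_eq_zero fun l _ => ?_
    have := hu _ (p l).2
    calc _ = v l * ∑ j, u j * polyFun (p l : MvPolynomial (Fin d) ℝ) (x j) := by
          rw [Finset.mul_sum]; exact Finset.sum_congr rfl fun j _ => by ring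
      _ = 0 := by rw [this, mul_zero]
  rw [h2, add_zero, Finset.sum_comm, sub_eq_zero]
  exact Finset.sum_congr rfl fun i _ => Finset.sum_congr rfl fun j _ => by ring

/-- The kernel-based formula minimizes the norm of the error functional among the formulas that
are exact for the polynomials of degree less than `s`. -/
theorem norm_errorVector_le_of_isKernelWeight (hK : IsCPD K Ω s) (hU : IsOpen U) (hUΩ : U ⊆ Ω)
    (hKr : HasContinuousPartials K r U) {k M : ℕ} (hk : k ≤ r) (a : (Fin d → ℕ) → Pt d → ℝ)
    {z : Pt d} (hz : z ∈ U) {x : Fin N → Pt d} (hx : ∀ j, x j ∈ U)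
    (p : Module.Basis (Fin M) ℝ (polySpace d s)) {w : Fin N → ℝ}
    (hw : IsKernelWeight K k a z x (fun i => (p i : MvPolynomial (Fin d) ℝ)) w)
    {w' : Fin N → ℝ} (hw' : IsExactBelow k a z x s w') :
    ‖A.errorVector k a z x w‖ ≤ ‖A.errorVector k a z x w'‖ := by
  have hu : ∀ p ∈ polySpace d s, ∑ j, (w - w') j * polyFun p (x j) = 0 := fun p' hp' => by
    simp only [Pi.sub_apply, sub_mul, Finset.sum_sub_distrib]
    rw [hw.2.isExactBelow p' hp', hw' p' hp', sub_self]
  have h0 := A.inner_errorVector_eq_zero hK hU hUΩ hKr hk a hz hx p hw hu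
  have h1 : A.errorVector k a z x w' = A.errorVector k a z x w +
      ∑ j, (w - w') j • A.Ψ 0 (x j) := by
    simp only [errorVector, Pi.sub_apply, sub_smul, Finset.sum_sub_distrib]; abel
  refine (abs_le_of_sq_le_sq' ?_ (norm_nonneg _)).2
  rw [h1, norm_add_sq_real, h0]
  nlinarith [sq_nonneg ‖∑ j, (w - w') j • A.Ψ 0 (x j)‖]

/-- The error of a formula that is exact for the polynomials of degree less than `q`. -/
theorem norm_errorVector_le (hU : IsOpen U) {k : ℕ} (a : (Fin d → ℕ) → Pt d → ℝ)
    {z : Pt d} (hz : z ∈ U) {x : Fin N → Pt d} (hS : starSet z x ⊆ U) {m : ℕ} (hs : s ≤ m + 1)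
    (hkm : k ≤ m) (hm : m < r) {w : Fin N → ℝ} (hw : IsExactBelow k a z x (m + 1) w) {ρ : ℝ}
    (hρ : ∑ j, |w j| * ‖x j - z‖ ^ (m + 1) ≤ ρ) :
    ‖A.errorVector k a z x w‖ ≤ ρ * √(kernelSeminorm K z x m 1).toReal := by
  set e := A.errorVector k a z x w with he
  set C := √(kernelSeminorm K z x m 1).toReal with hC
  have hC0 : 0 ≤ C := Real.sqrt_nonneg _
  obtain ⟨T, hT, hTz, hTx⟩ := A.exists_taylor_error_le hU hz hS hs hm e
  -- The error functional applied to its own representer, minus that of `T`, which is zero. The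
  -- derivatives at `z` agree up to order `k ≤ m`, so only point values remain.
  have h1 : ‖e‖ ^ 2 = -∑ j, w j * (inner ℝ (A.Ψ 0 (x j)) e - polyFun T (x j)) := by
    have h2 := A.inner_errorVector k a z x w e
    have h3 := hw T hT
    rw [diffOp_polyFun, familyOp_congr (G := fun α y => inner ℝ (A.Ψ α y) e) fun α hα =>
      hTz α (hα.trans hkm)] at h3
    rw [← he, real_inner_self_eq_norm_sq] at h2
    rw [h2, ← h3]
    simp only [mul_sub, Finset.sum_sub_distrib]
    ring
  have h2 : ‖e‖ ^ 2 ≤ ρ * C * ‖e‖ := by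
    calc ‖e‖ ^ 2 ≤ |∑ j, w j * (inner ℝ (A.Ψ 0 (x j)) e - polyFun T (x j))| := by
          rw [h1]; exact neg_le_abs _
      _ ≤ ∑ j, |w j| * (‖x j - z‖ ^ (m + 1) * C * ‖e‖) := by
          refine (Finset.abs_sum_le_sum_abs _ _).trans (Finset.sum_le_sum fun j _ => ?_)
          rw [abs_mul]
          exact mul_le_mul_of_nonneg_left (hTx j) (abs_nonneg _)
      _ = (∑ j, |w j| * ‖x j - z‖ ^ (m + 1)) * (C * ‖e‖) := by
          rw [Finset.sum_mul]; exact Finset.sum_congr rfl fun j _ => by ring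
      _ ≤ ρ * (C * ‖e‖) := by gcongr
      _ = _ := by ring
  have hρ0 : 0 ≤ ρ := le_trans (by positivity) hρ
  rcases (norm_nonneg e).eq_or_lt with h0 | hpos
  · rw [← h0]; positivity
  · rw [sq] at h2
    exact le_of_mul_le_mul_right h2 hpos

end FeatureMap

/-- The limit of the seminorms becomes the norm of a vector in `H`, so Cauchy–Schwarz there bounds
the error for each approximating sequence separately. -/
theorem IsNativeApprox.exists_tendsto_norm {d : ℕ} {K : Pt d → Pt d → ℝ} {Ω U : Set (Pt d)}
    {s r : ℕ} {H : Type*} [NormedAddCommGroup H] [InnerProductSpace ℝ H] [CompleteSpace H]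
    (A : FeatureMap K Ω U s r H) (hUΩ : U ⊆ Ω) {f : Pt d → ℝ} {c : ℕ → Pt d →₀ ℝ}
    {p : ℕ → MvPolynomial (Fin d) ℝ} (hf : IsNativeApprox K Ω s f c p) :
    ∃ g : H, Tendsto (fun n => √(quadForm K (c n))) atTop (𝓝 ‖g‖) ∧
      ∀ y ∈ U, f y = inner ℝ (A.Ψ 0 y) g + ∑ ξ : A.nodes, f ξ * polyFun (A.cardinal ξ) y := by
  obtain ⟨g, hg, hfg⟩ := A.exists_representer hUΩ hf
  refine ⟨g, ?_, hfg⟩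
  have := hg.norm
  simpa only [A.norm_J] using this

/-- A bound by all approximating sequences is a bound by the native seminorm. -/
theorem le_mul_nativeNorm {d : ℕ} {K : Pt d → Pt d → ℝ} {Ω : Set (Pt d)} {s : ℕ} {f : Pt d → ℝ}
    (hne : ∃ C c p, IsNativeApprox K Ω s f c p ∧
      Tendsto (fun n => √(quadForm K (c n))) atTop (𝓝 C)) {E B : ℝ} (hB : 0 ≤ B)
    (h : ∀ C c p, IsNativeApprox K Ω s f c p →
      Tendsto (fun n => √(quadForm K (c n))) atTop (𝓝 C) → E ≤ B * C) :
    E ≤ B * nativeNorm K Ω s f := by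
  -- For `B = 0` division is impossible, and a single approximating sequence suffices.
  rcases hB.eq_or_lt with h0 | hpos
  · obtain ⟨C, c, p, h1, h2⟩ := hne
    have := h C c p h1 h2
    rw [← h0, zero_mul] at this ⊢
    exact this
  · rw [← div_le_iff₀' hpos]
    refine le_csInf hne ?_
    rintro C ⟨c, p, h1, h2⟩
    rw [div_le_iff₀' hpos]
    exact h C c p h1 h2

end

end KernelDiff

/-! ### The error estimate -/

theorem corollary1 (d s k r N M : ℕ) (hN : 0 < N)
    (Ω U : Set (KernelDiff.Pt d)) (K : KernelDiff.Pt d → KernelDiff.Pt d → ℝ)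
    (hK : KernelDiff.IsCPD K Ω s)
    (a : (Fin d → ℕ) → KernelDiff.Pt d → ℝ)
    (z : KernelDiff.Pt d) (hz : z ∈ Ω)
    (x : Fin N → KernelDiff.Pt d) (hx : Function.Injective x)
    (hU : IsOpen U) (hSU : KernelDiff.starSet z x ⊆ U) (hUΩ : U ⊆ Ω)
    (hrk : k ≤ r) (hKr : KernelDiff.HasContinuousPartials K r U)
    (p : Module.Basis (Fin M) ℝ (KernelDiff.polySpace d s))
    (hcons : ∃ w : Fin N → ℝ,
      KernelDiff.IsExactOn k a z x (fun i => (p i : MvPolynomial (Fin d) ℝ)) w) :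
    (∃! w : Fin N → ℝ,
      KernelDiff.IsKernelWeight K k a z x (fun i => (p i : MvPolynomial (Fin d) ℝ)) w) ∧
    ∀ q : ℕ, max s (k + 1) ≤ q → q ≤ r →
      KernelDiff.kernelSeminorm K z x (q - 1) 1 ≠ ∞ ∧
      ∀ f ∈ KernelDiff.nativeSpace K Ω s,
        KernelDiff.HasPartialsNear f k z ∧
        ∀ w : Fin N → ℝ,
          KernelDiff.IsKernelWeight K k a z x (fun i => (p i : MvPolynomial (Fin d) ℝ)) w →
          KernelDiff.growthFunction k a q z x (q : ℝ) ≠ ∞ →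
          |KernelDiff.diffOp k a f z - ∑ j, w j * f (x j)| ≤
            (KernelDiff.growthFunction k a q z x (q : ℝ)).toReal *
              Real.sqrt (KernelDiff.kernelSeminorm K z x (q - 1) 1).toReal *
              KernelDiff.nativeNorm K Ω s f := by
  have hxU : ∀ j, x j ∈ U := fun j => hSU (KernelDiff.node_mem_starSet z x j)
  have hzU : z ∈ U := by
    have := KernelDiff.mem_starSet z x ⟨0, hN⟩ (t := 0) (by simp)
    exact hSU (by simpa using this)
  refine ⟨KernelDiff.existsUnique_kernelWeight hK a z hx (fun j => hUΩ (hxU j)) p hcons, ?_⟩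
  obtain ⟨H, _, _, _, ⟨A⟩⟩ := KernelDiff.exists_featureMap hK hU hUΩ hKr
  rintro q hq hqr
  obtain ⟨m, rfl⟩ : ∃ m, q = m + 1 := ⟨q - 1, by omega⟩
  have hs : s ≤ m + 1 := (le_max_left _ _).trans hq
  have hkm : k ≤ m := by have := (le_max_right s (k + 1)).trans hq; omega
  rw [Nat.add_sub_cancel]
  refine ⟨KernelDiff.kernelSeminorm_ne_top
    (A.holderSeminorm_kernelPartial_ne_top hU hzU hSU hs (by omega)), ?_⟩
  rintro f ⟨c, pol, hf⟩
  refine ⟨?_, fun w hw hρ => ?_⟩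
  · obtain ⟨g, -, hg⟩ := hf.exists_tendsto_norm A hUΩ
    exact (A.isPartialFamily_functionFamily g _).hasPartialsNear hU (A.eqOn_functionFamily hg)
      hrk hzU
  · obtain ⟨w', hw', hwρ⟩ :=
      KernelDiff.exists_weights_of_growthFunction (Nat.succ_pos m) a z hx hρ
    have h1 := A.norm_errorVector_le hU a hzU hSU hs hkm (by omega) hw' hwρ
    -- The competitor is exact on `Π_q`, hence on `Π_s` because `s ≤ q`, so the kernel weights do at
    -- least as well.
    have h2 := A.norm_errorVector_le_of_isKernelWeight hK hU hUΩ hKr hrk a hzU hxU p hw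
      (fun p' hp' => hw' p' (KernelDiff.polySpace_mono hs hp'))
    refine KernelDiff.le_mul_nativeNorm ?_ (by positivity) fun C c pol hf hC => ?_
    · obtain ⟨g, hg, -⟩ := hf.exists_tendsto_norm A hUΩ
      exact ⟨_, c, pol, hf, hg⟩
    · obtain ⟨g, hg, hfg⟩ := hf.exists_tendsto_norm A hUΩ
      rw [tendsto_nhds_unique hC hg, A.error_eq_inner hU hrk a hzU hxU hw.2.isExactBelow hfg]
      exact (abs_real_inner_le_norm _ _).trans
        (mul_le_mul_of_nonneg_right (h2.trans h1) (norm_nonneg _))
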